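/- **Model.** There are processes $1,\dots,n$, shared variables $x$ with a memory content $\mathsf m(x)$, and for every process $i$ a FIFO store buffer, emptied by a dispatcher $d_i$. The processes and the dispatchers are the *agents*; a *node* $\langle b,t\rangle$ is an agent $b$ with a time $t\in\mathbb N$. The local state of a process is the list of its observations so far (its actions, the values its reads returned, and invocations), initially empty. An implementation gives an initial memory and, for each process and local state, a nonempty set of allowed actions. In every round $t+1$ of a run (infinite, starting with empty buffers), each process performs the null action or an allowed, enabled action, namely: a read of $x$ (which returns the newest entry for $x$ in its own buffer (*read from buffer*, RfB) if there is one, otherwise $\mathsf m(x)$ (*read from memory*, RfM)); a write (which appends an entry to its buffer); a fence F (enabled iff its buffer is empty); $\mathrm{RMW}(x,v,v')$ (enabled iff its buffer is empty and $\mathsf m(x)=v$; sets $\mathsf m(x):=v'$); an internal action; or a response $\mathtt{return}$. Each $d_i$ may perform $\mathtt{prop}$, enabled iff $i$'s buffer is nonempty, which moves the oldest entry $(x,v)$ to memory; and the environment may invoke an operation at each process. Enabledness and the values read refer to the state at time $t$; these are the actions *at* the nodes $\langle b,t\rangle$. An RfM of $x$, an RMW on $x$ and a $\mathtt{prop}$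 of an entry for $x$ are the *memory accesses* of $x$. No two actions of a round may conflict, i.e. be memory accesses of the same variable, unless both are RfM, or one is by $d_i$ and the other is an RfM by $i$. **Occurs-before.** $\overset{ob}{\rightsquigarrow}_r$ is the least transitive relation on nodes such that for all $t<t'$: (1) $\langle b,t\rangle\overset{ob}{\rightsquigarrow}_r\langle b,t'\rangle$; (2) $\langle i,t\rangle\overset{ob}{\rightsquigarrow}_r\langle d_i,t'\rangle$ if the entry written, or read from the buffer, at $\langle i,t\rangle$ is propagated at $\langle d_i,t'\rangle$; (3) $\langle b,t\rangle\overset{ob}{\rightsquigarrow}_r\langle c,t'\rangle$ if both actions are memory accesses of the same variable, except if both are RfM, or if $b=d_i$, $c=i$ and the action at $\langle i,t'\rangle$ is an RfM; (4) $\langle d_i,t\rangle\overset{ob}{\rightsquigarrow}_r\langle i,t'\rangle$ if $d_i$ propagates at time $t$ and $i$ performs F or an RMW at time $t'$. **Operations.** An operation $\mathrm X$ invoked at process $i$ in round $t+1$ has $\mathrm X.s=\langle i,t\rangle$ and $t_{\mathrm X.s}=t$; if its matching response (the first response of $i$ in a later round) is performed in round $t'$, it *completes*, with $\mathrm X.e=\langle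 i,t'\rangle$ and $t_{\mathrm X.e}=t'$. Write $\mathrm X<_r\mathrm Y$ if $\mathrm X$ completes and $t_{\mathrm X.e}<t_{\mathrm Y.s}$; two operations not ordered by $<_r$ are concurrent. $\mathrm Y$ *runs in isolation* in $r$ if no other operation of $r$ is concurrent to it. $\mathrm X\overset{ob}{\rightsquigarrow}_r\mathrm Y$ means $\mathrm X.s\overset{ob}{\rightsquigarrow}_r\mathrm Y.e$. For a multi-writer multi-reader register with default value $v_0$, an *$\mathsf a$-operation* $\mathrm X\mathsf a$ is a write of $\mathsf a$ or a read that returns $\mathsf a$. Throughout, a process is invoked again only after a response in an earlier round to its previous invocation, each value is written at most once in a run, and $v_0$ is not written. An implementation is a *linearizable register implementation* if in each of its runs all completed operations and some of the pending ones can be arranged in a sequence that extends $<_r$, in which each completed read returns the value of the most recent preceding write ($v_0$ if there is none) and each completed write returns an acknowledgement. It is *obstruction-free* if, whenever an operation of a process $i$ is pending at time $T$ in a run, some run that agrees with it up to time $T$ completes that operation although from time $T$ on nothing is invoked and no process other than $i$ takes a step (dispatchers may propagate). **Theorem.** Let $r$ be a run of an obstruction-free linearizable register implementation in TSO, such that in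 no round of $r$ a process reads from its store buffer the very entry that its dispatcher propagates in that same round. Let $\mathrm X\mathsf a<_r\mathrm Y\mathsf b$ with $\mathsf a\ne\mathsf b$, and suppose that $\mathrm Y\mathsf b$ completes and runs in isolation in $r$. Then $\mathrm X\mathsf a\overset{ob}{\rightsquigarrow}_r\mathrm Y\mathsf b$. -/

import Mathlib

namespace TSO

/-! ### Agents, actions, local records -/

/-- The agents: the processes `i` and their local dispatchers `d_i`. -/
inductive Agent (n : ℕ) where
  | proc (i : Fin n)
  | disp (i : Fin n)

/-- A node `⟨b, t⟩`: the point at time `t` on the timeline of agent `b`. -/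
abbrev Node (n : ℕ) := Agent n × ℕ

/-- The two operations of a register with values in `V`, as invoked by the environment. -/
inductive RegOp (V : Type*) where
  | read
  | write (v : V)

/-- The responses of a register: the value returned by a read, the acknowledgement of a write. -/
inductive RegResp (V : Type*) where
  | val (v : V)
  | ack

/-- Actions of a process: the TSO actions, internal actions, and the response that ends the
pending operation.  `null` is the null action. -/
inductive Act (Var Val Lbl V : Type*) where
  | null
  | read (x : Var)
  | write (x : Var) (v : Val)
  | rmw (x : Var) (expected new : Val)
  | fence
  | internal (c : Lbl)
  | ret (w : RegResp V)

/-- What is recorded in the local state of a process.  A read is recorded with the value that it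
returned, but without its source (store buffer or memory). -/
inductive Rec (Var Val Lbl V : Type*) where
  | read (x : Var) (v : Val)
  | write (x : Var) (v : Val)
  | rmw (x : Var) (expected new : Val)
  | fence
  | internal (c : Lbl)
  | ret (w : RegResp V)
  | invoke (o : RegOp V)

/-- A local state: the list of everything observed so far, oldest first. -/
abbrev Local (Var Val Lbl V : Type*) := List (Rec Var Val Lbl V)

/-- The number of write events recorded in a local state. -/
def writeCount {Var Val Lbl V : Type*} : Local Var Val Lbl V → ℕ
  | [] => 0
  | Rec.write _ _ :: l => writeCount l + 1
  | _ :: l => writeCount l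

/-- An entry `⟨var, val⟩` of a store buffer.  The auxiliary field `idx` is `k` when the entry was
created by the `k`-th write of the owner of the buffer, so `⟨owner, idx⟩` is the tag of the entry.
No action and no local state depends on `idx`. -/
structure Item (Var Val : Type*) where
  var : Var
  val : Val
  idx : ℕ

/-- The newest entry for `x` in the store buffer `β` (oldest entry first), if there is one. -/
def lastItem {Var Val : Type*} [DecidableEq Var] (β : List (Item Var Val)) (x : Var) :
    Option (Item Var Val) :=
  (β.filter (fun it => decide (it.var = x))).getLast?

/-- A global state: main memory, store buffers (oldest entry first), local states. -/
structure GState (n : ℕ) (Var Val Lbl V : Type*) where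
  mem : Var → Val
  buf : Fin n → List (Item Var Val)
  loc : Fin n → Local Var Val Lbl V

/-- The value that a read of `x` by process `i` returns in state `σ`. -/
def GState.readVal {n : ℕ} {Var Val Lbl V : Type*} [DecidableEq Var]
    (σ : GState n Var Val Lbl V) (i : Fin n) (x : Var) : Val :=
  match lastItem (σ.buf i) x with
  | some it => it.val
  | none => σ.mem x

/-- The precondition of an action of process `i` in state `σ`. -/
def GState.Enabled {n : ℕ} {Var Val Lbl V : Type*}
    (σ : GState n Var Val Lbl V) (i : Fin n) : Act Var Val Lbl V → Prop
  | Act.fence => σ.buf i = []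
  | Act.rmw x e _ => σ.buf i = [] ∧ σ.mem x = e
  | _ => True

/-- What an action of process `i`, taken in state `σ`, adds to the local state of `i`. -/
def GState.record {n : ℕ} {Var Val Lbl V : Type*} [DecidableEq Var]
    (σ : GState n Var Val Lbl V) (i : Fin n) : Act Var Val Lbl V → Local Var Val Lbl V
  | Act.null => []
  | Act.read x => [Rec.read x (σ.readVal i x)]
  | Act.write x v => [Rec.write x v]
  | Act.rmw x e w => [Rec.rmw x e w]
  | Act.fence => [Rec.fence]
  | Act.internal c => [Rec.internal c]
  | Act.ret w => [Rec.ret w]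

/-- What an action of process `i`, taken in state `σ`, adds to the tail of its store buffer. -/
def GState.newItems {n : ℕ} {Var Val Lbl V : Type*}
    (σ : GState n Var Val Lbl V) (i : Fin n) : Act Var Val Lbl V → List (Item Var Val)
  | Act.write x v => [⟨x, v, writeCount (σ.loc i) + 1⟩]
  | _ => []

/-! ### Runs -/

/-- A sequence of global states together with the joint actions: in round `t + 1`, at
`state t`, process `i` performs `act t i`, the dispatcher `d_i` propagates iff `prop t i`, and the
environment invokes `o` at process `i` iff `inv t i = some o`.  The conditions that make it a run
are in `Run.IsRunOf`. -/
structure Run (n : ℕ) (Var Val Lbl V : Type*) where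
  state : ℕ → GState n Var Val Lbl V
  act : ℕ → Fin n → Act Var Val Lbl V
  prop : ℕ → Fin n → Prop
  inv : ℕ → Fin n → Option (RegOp V)

/-- A register implementation: a (nondeterministic) protocol for every process, and the initial
content of the memory. -/
structure RegImpl (n : ℕ) (Var Val Lbl V : Type*) where
  protocol : Fin n → Local Var Val Lbl V → Set (Act Var Val Lbl V)
  nonempty : ∀ i l, (protocol i l).Nonempty
  init : Var → Val

namespace Run

variable {n : ℕ} {Var Val Lbl V : Type*} [DecidableEq Var]

/-- `⟨d_i, t⟩` propagates the buffer entry `it`. -/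
def IsProp (r : Run n Var Val Lbl V) (i : Fin n) (t : ℕ) (it : Item Var Val) : Prop :=
  r.prop t i ∧ ((r.state t).buf i).head? = some it

/-- `⟨i, t⟩` reads the entry `it` from the store buffer of `i`. -/
def IsRfB (r : Run n Var Val Lbl V) (i : Fin n) (t : ℕ) (it : Item Var Val) : Prop :=
  ∃ x, r.act t i = Act.read x ∧ lastItem ((r.state t).buf i) x = some it

/-- `⟨i, t⟩` reads `x` from memory. -/
def IsRfM (r : Run n Var Val Lbl V) (i : Fin n) (t : ℕ) (x : Var) : Prop :=
  r.act t i = Act.read x ∧ lastItem ((r.state t).buf i) x = none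

/-- `⟨i, t⟩` is a read-modify-write of `x`. -/
def IsRMW (r : Run n Var Val Lbl V) (i : Fin n) (t : ℕ) (x : Var) : Prop :=
  ∃ e w, r.act t i = Act.rmw x e w

/-- The action at node `⟨b, t⟩` is a memory access of the variable `x`. -/
def MemAccess (r : Run n Var Val Lbl V) (x : Var) : Node n → Prop
  | (Agent.proc i, t) => r.IsRfM i t x ∨ r.IsRMW i t x
  | (Agent.disp i, t) => ∃ it, r.IsProp i t it ∧ it.var = x

/-- The action at node `⟨b, t⟩` is a read from memory. -/
def NodeRfM (r : Run n Var Val Lbl V) : Node n → Prop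
  | (Agent.proc i, t) => ∃ x, r.IsRfM i t x
  | (Agent.disp _, _) => False

/-- The actions of the distinct agents `b` and `c` at time `t` are conflicting. -/
def Conflict (r : Run n Var Val Lbl V) (t : ℕ) (b c : Agent n) : Prop :=
  ¬ (r.NodeRfM (b, t) ∧ r.NodeRfM (c, t)) ∧
  (∃ x, r.MemAccess x (b, t) ∧ r.MemAccess x (c, t)) ∧
  ¬ (∃ i, (b = Agent.disp i ∧ c = Agent.proc i ∧ r.NodeRfM (c, t)) ∨
          (c = Agent.disp i ∧ b = Agent.proc i ∧ r.NodeRfM (b, t)))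

/-- The effect of the joint action of round `t + 1`.  The memory accesses of a round do not
conflict, so the order in which the actions of a round are carried out matters only for a store
buffer, where the process appends before its dispatcher removes. -/
structure Transition (r : Run n Var Val Lbl V) (t : ℕ) : Prop where
  loc : ∀ i, (r.state (t + 1)).loc i =
    (r.state t).loc i ++ (r.state t).record i (r.act t i) ++
      ((r.inv t i).map Rec.invoke).toList
  buf_prop : ∀ i, r.prop t i → (r.state (t + 1)).buf i =
    ((r.state t).buf i ++ (r.state t).newItems i (r.act t i)).tail
  buf_idle : ∀ i, ¬ r.prop t i → (r.state (t + 1)).buf i =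
    (r.state t).buf i ++ (r.state t).newItems i (r.act t i)
  mem_rmw : ∀ i x e w, r.act t i = Act.rmw x e w → (r.state (t + 1)).mem x = w
  mem_prop : ∀ i it, r.IsProp i t it → (r.state (t + 1)).mem it.var = it.val
  mem_idle : ∀ x, (∀ i, ¬ r.IsRMW i t x) → (∀ i it, r.IsProp i t it → it.var ≠ x) →
    (r.state (t + 1)).mem x = (r.state t).mem x

/-- `r` is a TSO run of the implementation `I`. -/
structure IsRunOf (r : Run n Var Val Lbl V) (I : RegImpl n Var Val Lbl V) : Prop where
  init_mem : (r.state 0).mem = I.init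
  init_buf : ∀ i, (r.state 0).buf i = []
  init_loc : ∀ i, (r.state 0).loc i = []
  enabled_act : ∀ t i, (r.state t).Enabled i (r.act t i)
  enabled_prop : ∀ t i, r.prop t i → (r.state t).buf i ≠ []
  no_conflict : ∀ t b c, b ≠ c → ¬ r.Conflict t b c
  transition : ∀ t, r.Transition t
  consistent : ∀ t i, r.act t i ≠ Act.null → r.act t i ∈ I.protocol i ((r.state t).loc i)

/-! ### The occurs-before relation -/

/-- `⟨i, t⟩` is a write, or a read from the buffer, with tag `⟨i, k⟩`. -/
def BufferTag (r : Run n Var Val Lbl V) (i : Fin n) (t k : ℕ) : Prop :=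
  (∃ x v, r.act t i = Act.write x v ∧ k = writeCount ((r.state t).loc i) + 1) ∨
  (∃ it, r.IsRfB i t it ∧ k = it.idx)

/-- `⟨d_i, t⟩` is a propagation with tag `⟨i, k⟩`. -/
def PropTag (r : Run n Var Val Lbl V) (i : Fin n) (t k : ℕ) : Prop :=
  ∃ it, r.IsProp i t it ∧ k = it.idx

/-- The occurs-before relation between the nodes of `r`. -/
inductive OB (r : Run n Var Val Lbl V) : Node n → Node n → Prop
  | locality (b : Agent n) (t t' : ℕ) (ht : t < t') : OB r (b, t) (b, t')
  | buffer (i : Fin n) (t t' k : ℕ) (ht : t < t')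
      (h : r.BufferTag i t k) (h' : r.PropTag i t' k) :
      OB r (Agent.proc i, t) (Agent.disp i, t')
  | access (b c : Agent n) (t t' : ℕ) (x : Var) (ht : t < t')
      (h : r.MemAccess x (b, t)) (h' : r.MemAccess x (c, t'))
      (notReads : ¬ (r.NodeRfM (b, t) ∧ r.NodeRfM (c, t')))
      (notOwn : ¬ ∃ i, b = Agent.disp i ∧ c = Agent.proc i ∧ r.NodeRfM (c, t')) :
      OB r (b, t) (c, t')
  | sync (i : Fin n) (t t' : ℕ) (ht : t < t') (h : r.prop t i)
      (h' : r.act t' i = Act.fence ∨ ∃ x, r.IsRMW i t' x) :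
      OB r (Agent.disp i, t) (Agent.proc i, t')
  | trans (θ η ζ : Node n) (h : OB r θ η) (h' : OB r η ζ) : OB r θ ζ

/-! ### Operations -/

end Run

/-- The name of an operation of a run: the process `i` at which it is invoked and its starting
time `t`, where the invocation takes place in round `t + 1`. -/
abbrev Op (n : ℕ) := Fin n × ℕ

namespace Run

variable {n : ℕ} {Var Val Lbl V : Type*}

/-- `X` is an operation of `r`. -/
def IsOp (r : Run n Var Val Lbl V) (X : Op n) : Prop := r.inv X.2 X.1 ≠ none

/-- The process of the operation `X` performs the matching response, with result `w`, in round
`e`: the first response in a round after that of the invocation. -/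
def Returns (r : Run n Var Val Lbl V) (X : Op n) (e : ℕ) (w : RegResp V) : Prop :=
  r.IsOp X ∧ ∃ s, e = s + 1 ∧ X.2 < s ∧ r.act s X.1 = Act.ret w ∧
    ∀ u w', X.2 < u → u < s → r.act u X.1 ≠ Act.ret w'

/-- The operation `X` completes in `r`. -/
def Completes (r : Run n Var Val Lbl V) (X : Op n) : Prop := ∃ e w, r.Returns X e w

/-- `X` precedes `Y` in real time: the ending time of `X` is smaller than the starting time
of `Y`. -/
def Precedes (r : Run n Var Val Lbl V) (X Y : Op n) : Prop :=
  r.IsOp Y ∧ ∃ e w, r.Returns X e w ∧ e < Y.2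

/-- `X` runs in isolation: no other operation of `r` is concurrent to it. -/
def Isolated (r : Run n Var Val Lbl V) (X : Op n) : Prop :=
  ∀ Z, r.IsOp Z → Z ≠ X → r.Precedes Z X ∨ r.Precedes X Z

/-- `X` is a `v`-operation: a write of `v`, or a read that returns `v`. -/
def IsValOp (r : Run n Var Val Lbl V) (X : Op n) (v : V) : Prop :=
  r.inv X.2 X.1 = some (RegOp.write v) ∨
  (r.inv X.2 X.1 = some RegOp.read ∧ ∃ e, r.Returns X e (RegResp.val v))

/-- `X` occurs before `Y`: the starting node of `X` occurs before the ending node of `Y`. -/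
def OpOB [DecidableEq Var] (r : Run n Var Val Lbl V) (X Y : Op n) : Prop :=
  ∃ e w, r.Returns Y e w ∧ r.OB (Agent.proc X.1, X.2) (Agent.proc Y.1, e)

/-- The conventions on the environment: a process is not invoked again before it has responded to
the previous invocation, every value is written at most once, and the default value `v₀`, which
the register holds initially, is not written. -/
structure WellFormed (r : Run n Var Val Lbl V) (v₀ : V) : Prop where
  sequential : ∀ i t t', t < t' → r.IsOp (i, t) → r.IsOp (i, t') →
    ∃ s w, t < s ∧ s < t' ∧ r.act s i = Act.ret w
  unique_write : ∀ (X Y : Op n) (v : V), r.inv X.2 X.1 = some (RegOp.write v) →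
    r.inv Y.2 Y.1 = some (RegOp.write v) → X = Y
  default_not_written : ∀ X : Op n, r.inv X.2 X.1 ≠ some (RegOp.write v₀)

/-- In no round does a process read from its store buffer the very entry that its dispatcher
propagates in that round. -/
def NoReadPropRace [DecidableEq Var] (r : Run n Var Val Lbl V) : Prop :=
  ∀ i t it, ¬ (r.IsRfB i t it ∧ r.IsProp i t it)

/-- `W` is a write of `v` in `r`. -/
def IsWriteOp (r : Run n Var Val Lbl V) (W : Op n) (v : V) : Prop :=
  r.inv W.2 W.1 = some (RegOp.write v)

/-- When the operations in `L` take effect in the order of their positions `pos`, the register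
holds `v` just before `X`: `v` was written by the most recent write, or it is the default value
and there is no earlier write. -/
def HoldsBefore (r : Run n Var Val Lbl V) (v₀ : V) (L : Set (Op n)) (pos : Op n → ℕ)
    (X : Op n) (v : V) : Prop :=
  (∃ W ∈ L, r.IsWriteOp W v ∧ pos W < pos X ∧
    ∀ W' ∈ L, ∀ v', r.IsWriteOp W' v' → pos W' < pos X → pos W' ≤ pos W) ∨
  (v = v₀ ∧ ∀ W ∈ L, ∀ v', r.IsWriteOp W v' → ¬ pos W < pos X)

/-- `r` is linearizable with respect to the register with default value `v₀`: all completed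
operations, with some of the pending ones, can be arranged in a sequence that respects real-time
order and in which all responses are those of a register. -/
def IsLinearizable (r : Run n Var Val Lbl V) (v₀ : V) : Prop :=
  ∃ (L : Set (Op n)) (pos : Op n → ℕ),
    (∀ X ∈ L, r.IsOp X) ∧
    (∀ X, r.Completes X → X ∈ L) ∧
    Set.InjOn pos L ∧
    (∀ X ∈ L, ∀ Y ∈ L, r.Precedes X Y → pos X < pos Y) ∧
    (∀ X e w, r.Returns X e w → r.inv X.2 X.1 = some RegOp.read →
      ∃ v, w = RegResp.val v ∧ r.HoldsBefore v₀ L pos X v) ∧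
    (∀ X e w v, r.Returns X e w → r.IsWriteOp X v → w = RegResp.ack)

end Run

namespace RegImpl

variable {n : ℕ} {Var Val Lbl V : Type*} [DecidableEq Var]

/-- `I` is a linearizable implementation of the register with default value `v₀`. -/
def Linearizable (I : RegImpl n Var Val Lbl V) (v₀ : V) : Prop :=
  ∀ r : Run n Var Val Lbl V, r.IsRunOf I → r.WellFormed v₀ → r.IsLinearizable v₀

/-- `I` is obstruction-free: whenever the operation `X` is pending at time `T` of a run, there is
a run that agrees with it up to time `T`, in which from then on no other process takes a step and
nothing is invoked, and in which `X` completes.  (Dispatchers may propagate.) -/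
def ObstructionFree (I : RegImpl n Var Val Lbl V) (v₀ : V) : Prop :=
  ∀ r : Run n Var Val Lbl V, r.IsRunOf I → r.WellFormed v₀ →
    ∀ (X : Op n) (T : ℕ), r.IsOp X → X.2 < T → (∀ e w, r.Returns X e w → T < e) →
      ∃ r' : Run n Var Val Lbl V, r'.IsRunOf I ∧
        (∀ t ≤ T, r'.state t = r.state t) ∧
        (∀ t < T, r'.act t = r.act t ∧ r'.prop t = r.prop t ∧ r'.inv t = r.inv t) ∧
        (∀ t, T ≤ t → ∀ i, r'.inv t i = none) ∧
        (∀ t, T ≤ t → ∀ i, i ≠ X.1 → r'.act t i = Act.null) ∧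
        r'.Completes X

end RegImpl

end TSO

/-!
Suppose that `X.s` does not occur before `Y.e`.  Cut the run off when `Y` ends and invoke a read `R`
at the process of `Y`: by obstruction-freedom it completes, and it returns `b`, because `Y` ran in
isolation.  Now delay all nodes at or after `X.s` in the occurs-before relation by the same amount.
Since this relation contains all causal dependencies, the result is again a run, in which every
process goes through the same local states as before.  But now `X` starts after `Y` has ended, and
it still ends before `R` starts.  So an `a`-operation runs between two `b`-operations, which is
impossible for a linearizable register in which every value is written at most once.

The relation does not order a propagation by `d_i` before the reads of `i` from memory, so such a
read may become a read from the buffer in the delayed run.  It still returns the same value.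
-/

namespace TSO

namespace Run

/-! ### Gluing runs -/

section Gluing

variable {n : ℕ} {Var Val Lbl V : Type*}

/-- Round `t + 1` of `r` coincides with round `u + 1` of `q`, including the states before and
after it. -/
structure SameRound (r q : Run n Var Val Lbl V) (t u : ℕ) : Prop where
  state : r.state t = q.state u
  state_succ : r.state (t + 1) = q.state (u + 1)
  act : r.act t = q.act u
  prop : r.prop t = q.prop u
  inv : r.inv t = q.inv u

namespace SameRound

variable {r q : Run n Var Val Lbl V} {t u : ℕ}

theorem isProp_iff (h : r.SameRound q t u) {i : Fin n} {it : Item Var Val} :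
    r.IsProp i t it ↔ q.IsProp i u it := by
  simp only [IsProp, h.state, h.prop]

theorem isRMW_iff (h : r.SameRound q t u) {i : Fin n} {x : Var} :
    r.IsRMW i t x ↔ q.IsRMW i u x := by
  simp only [IsRMW, h.act]

end SameRound

/-- The first `A` rounds of `p`, followed by the rounds of `q` from time `B` on. -/
def glue (p : Run n Var Val Lbl V) (A : ℕ) (q : Run n Var Val Lbl V) (B : ℕ) :
    Run n Var Val Lbl V where
  state t := if t < A then p.state t else q.state (t - A + B)
  act t := if t < A then p.act t else q.act (t - A + B)
  prop t := if t < A then p.prop t else q.prop (t - A + B)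
  inv t := if t < A then p.inv t else q.inv (t - A + B)

section

variable {p q : Run n Var Val Lbl V} {A B t : ℕ}

theorem sameRound_glue_of_lt (h : p.state A = q.state B) (ht : t < A) :
    (p.glue A q B).SameRound p t t where
  state := if_pos ht
  state_succ := by
    rcases Nat.lt_or_eq_of_le (Nat.succ_le_of_lt ht) with ht' | rfl
    · exact if_pos ht'
    · simp [glue, h]
  act := if_pos ht
  prop := if_pos ht
  inv := if_pos ht

theorem sameRound_glue_of_le (ht : A ≤ t) : (p.glue A q B).SameRound q t (t - A + B) where
  state := if_neg (by omega)
  state_succ := by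
    rw [show t - A + B + 1 = t + 1 - A + B by omega]
    exact if_neg (by omega)
  act := if_neg (by omega)
  prop := if_neg (by omega)
  inv := if_neg (by omega)

end

variable [DecidableEq Var]

/-- The conditions that `IsRunOf` imposes on round `t + 1`. -/
structure ValidRound (r : Run n Var Val Lbl V) (I : RegImpl n Var Val Lbl V) (t : ℕ) : Prop where
  enabled_act : ∀ i, (r.state t).Enabled i (r.act t i)
  enabled_prop : ∀ i, r.prop t i → (r.state t).buf i ≠ []
  no_conflict : ∀ b c, b ≠ c → ¬ r.Conflict t b c
  transition : r.Transition t
  consistent : ∀ i, r.act t i ≠ Act.null → r.act t i ∈ I.protocol i ((r.state t).loc i)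

variable {I : RegImpl n Var Val Lbl V}

theorem IsRunOf.validRound {r : Run n Var Val Lbl V} (hr : r.IsRunOf I) (t : ℕ) :
    r.ValidRound I t :=
  ⟨hr.enabled_act t, hr.enabled_prop t, hr.no_conflict t, hr.transition t, hr.consistent t⟩

theorem IsRunOf.of_validRound {r q : Run n Var Val Lbl V} (hr : r.IsRunOf I)
    (h0 : q.state 0 = r.state 0) (hq : ∀ t, q.ValidRound I t) : q.IsRunOf I where
  init_mem := by rw [h0, hr.init_mem]
  init_buf := by rw [h0]; exact hr.init_buf
  init_loc := by rw [h0]; exact hr.init_loc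
  enabled_act t := (hq t).enabled_act
  enabled_prop t := (hq t).enabled_prop
  no_conflict t := (hq t).no_conflict
  transition t := (hq t).transition
  consistent t := (hq t).consistent

namespace SameRound

variable {r q : Run n Var Val Lbl V} {t u : ℕ}

theorem isRfM_iff (h : r.SameRound q t u) {i : Fin n} {x : Var} :
    r.IsRfM i t x ↔ q.IsRfM i u x := by
  simp only [IsRfM, h.state, h.act]

theorem memAccess_iff (h : r.SameRound q t u) {x : Var} {b : Agent n} :
    r.MemAccess x (b, t) ↔ q.MemAccess x (b, u) := by
  cases b <;> simp only [MemAccess, h.isProp_iff, h.isRfM_iff, h.isRMW_iff]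

theorem nodeRfM_iff (h : r.SameRound q t u) {b : Agent n} :
    r.NodeRfM (b, t) ↔ q.NodeRfM (b, u) := by
  cases b <;> simp only [NodeRfM, h.isRfM_iff]

theorem transition (h : r.SameRound q t u) (hq : q.Transition u) : r.Transition t where
  loc := by rw [h.state, h.state_succ, h.act, h.inv]; exact hq.loc
  buf_prop := by rw [h.state, h.state_succ, h.act, h.prop]; exact hq.buf_prop
  buf_idle := by rw [h.state, h.state_succ, h.act, h.prop]; exact hq.buf_idle
  mem_rmw := by rw [h.state_succ, h.act]; exact hq.mem_rmw
  mem_prop := by simp only [h.isProp_iff, h.state_succ]; exact hq.mem_prop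
  mem_idle := by
    simp only [h.isProp_iff, h.isRMW_iff, h.state, h.state_succ]; exact hq.mem_idle

theorem validRound (h : r.SameRound q t u) (hq : q.ValidRound I u) : r.ValidRound I t where
  enabled_act := by rw [h.state, h.act]; exact hq.enabled_act
  enabled_prop := by rw [h.state, h.prop]; exact hq.enabled_prop
  no_conflict b c hbc := by
    simpa only [Conflict, h.memAccess_iff, h.nodeRfM_iff] using hq.no_conflict b c hbc
  transition := h.transition hq.transition
  consistent := by rw [h.state, h.act]; exact hq.consistent

end SameRound

theorem IsRunOf.glue {p q : Run n Var Val Lbl V} {A B : ℕ} (hp : p.IsRunOf I)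
    (hq : ∀ t, B ≤ t → q.ValidRound I t) (h : p.state A = q.state B) :
    (p.glue A q B).IsRunOf I := by
  refine hp.of_validRound ?_ fun t => ?_
  · rcases Nat.eq_zero_or_pos A with rfl | hA
    · simp [Run.glue, h]
    · exact if_pos hA
  · rcases lt_or_ge t A with ht | ht
    · exact (sameRound_glue_of_lt h ht).validRound (hp.validRound t)
    · exact (sameRound_glue_of_le ht).validRound (hq _ (Nat.le_add_left _ _))

theorem validRound_of_idle {r : Run n Var Val Lbl V} {t : ℕ}
    (hact : ∀ i, r.act t i = Act.null) (hprop : ∀ i, ¬ r.prop t i)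
    (hbuf : (r.state (t + 1)).buf = (r.state t).buf)
    (hmem : (r.state (t + 1)).mem = (r.state t).mem)
    (hloc : ∀ i, (r.state (t + 1)).loc i =
      (r.state t).loc i ++ ((r.inv t i).map Rec.invoke).toList) : r.ValidRound I t where
  enabled_act i := by rw [hact]; trivial
  enabled_prop i h := (hprop i h).elim
  no_conflict b c _ hc := by
    obtain ⟨-, ⟨x, hb, -⟩, -⟩ := hc
    cases b <;> simp [MemAccess, IsRfM, IsRMW, IsProp, hact, hprop] at hb
  consistent i h := (h (hact i)).elim
  transition :=
    { loc := fun i => by simp [hloc, hact, GState.record]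
      buf_prop := fun i h => (hprop i h).elim
      buf_idle := fun i _ => by simp [hbuf, hact, GState.newItems]
      mem_rmw := fun i x e w h => by simp [hact] at h
      mem_prop := fun i it h => (hprop i h.1).elim
      mem_idle := fun x _ _ => by rw [hmem] }

end Gluing

end Run

/-! ### Store buffers: the entries written minus the entries propagated -/

section LastItem

variable {Var Val : Type*} [DecidableEq Var] {β γ : List (Item Var Val)} {x : Var}
  {it : Item Var Val}

theorem lastItem_append : lastItem (β ++ γ) x = (lastItem γ x).or (lastItem β x) := by
  simp [lastItem, List.getLast?_append]

theorem lastItem_cons :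
    lastItem (it :: β) x = (lastItem β x).or (if it.var = x then some it else none) := by
  rw [← List.singleton_append, lastItem_append]
  congr 1
  by_cases h : it.var = x <;> simp [lastItem, h]

theorem lastItem_eq_none : lastItem β x = none ↔ ∀ it ∈ β, it.var ≠ x := by
  simp [lastItem]

theorem mem_and_var_eq_of_lastItem (h : lastItem β x = some it) : it ∈ β ∧ it.var = x := by
  simpa using List.mem_of_getLast? h

theorem lastItem_drop_eq_some_of_le {k l : ℕ} (hkl : k ≤ l)
    (h : lastItem (β.drop l) x = some it) : lastItem (β.drop k) x = some it := by
  rw [← List.take_append_drop (l - k) (β.drop k), lastItem_append, List.drop_drop,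
    Nat.add_sub_cancel' hkl, h, Option.some_or]

theorem lastItem_drop_eq_none_of_le {k l : ℕ} (hkl : k ≤ l)
    (h : lastItem (β.drop k) x = none) : lastItem (β.drop l) x = none :=
  lastItem_eq_none.2 fun it hit =>
    lastItem_eq_none.1 h it ((List.drop_sublist_drop_left β hkl).subset hit)

theorem exists_getElem?_of_lastItem_drop {k : ℕ} (h : lastItem (β.drop k) x = some it) :
    ∃ l, k ≤ l ∧ β[l]? = some it ∧ ∀ m ≤ l, lastItem (β.drop m) x = some it := by
  obtain ⟨hmem, hx⟩ := mem_and_var_eq_of_lastItem h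
  obtain ⟨j, hj⟩ := List.mem_iff_getElem?.1 hmem
  rw [List.getElem?_drop] at hj
  refine ⟨k + j, Nat.le_add_right k j, hj, fun m hm => ?_⟩
  rcases le_total m k with hmk | hkm
  · exact lastItem_drop_eq_some_of_le hmk h
  · have hit : it ∈ β.drop m := List.mem_iff_getElem?.2
      ⟨k + j - m, by rw [List.getElem?_drop, Nat.add_sub_cancel' hm, hj]⟩
    obtain ⟨it', hit'⟩ := Option.ne_none_iff_exists'.1 fun hnone : lastItem (β.drop m) x = none =>
      lastItem_eq_none.1 hnone it hit hx
    rw [hit', ← lastItem_drop_eq_some_of_le hkm hit', h]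

end LastItem

theorem writeCount_append {Var Val Lbl V : Type*} (l l' : Local Var Val Lbl V) :
    writeCount (l ++ l') = writeCount l + writeCount l' := by
  induction l with
  | nil => simp [writeCount]
  | cons a l ih => cases a <;> simp [writeCount, ih]; omega

section GState

variable {n : ℕ} {Var Val Lbl V : Type*} [DecidableEq Var]

theorem GState.readVal_eq (σ : GState n Var Val Lbl V) (i : Fin n) (x : Var) :
    σ.readVal i x = (lastItem (σ.buf i) x).elim (σ.mem x) Item.val := by
  unfold GState.readVal
  cases lastItem (σ.buf i) x <;> rfl

theorem GState.writeCount_record (σ : GState n Var Val Lbl V) (i : Fin n)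
    (a : Act Var Val Lbl V) : writeCount (σ.record i a) = (σ.newItems i a).length := by
  cases a <;> simp [GState.newItems, GState.record, writeCount]

end GState

namespace Run

section Buffers

variable {n : ℕ} {Var Val Lbl V : Type*}

/-- The entries that process `i` writes before time `t`, oldest first. -/
def writes (r : Run n Var Val Lbl V) (i : Fin n) : ℕ → List (Item Var Val)
  | 0 => []
  | t + 1 => r.writes i t ++ (r.state t).newItems i (r.act t i)

open Classical in
/-- The number of entries that `d_i` propagates before time `t`. -/
noncomputable def propCount (r : Run n Var Val Lbl V) (i : Fin n) : ℕ → ℕ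
  | 0 => 0
  | t + 1 => r.propCount i t + if r.prop t i then 1 else 0

variable {r : Run n Var Val Lbl V} {i : Fin n} {s t k : ℕ}

theorem writes_prefix (r : Run n Var Val Lbl V) (i : Fin n) (h : s ≤ t) :
    r.writes i s <+: r.writes i t := by
  induction t, h using Nat.le_induction with
  | base => exact List.prefix_rfl
  | succ t _ ih => exact ih.trans (List.prefix_append _ _)

theorem getElem?_writes_eq (hs : k < (r.writes i s).length) (ht : k < (r.writes i t).length) :
    (r.writes i s)[k]? = (r.writes i t)[k]? := by
  wlog hst : s ≤ t generalizing s t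
  · exact (this ht hs (le_of_not_ge hst)).symm
  rw [List.getElem?_eq_getElem hs, List.getElem?_eq_getElem ht, (writes_prefix r i hst).getElem hs]

theorem length_writes_lt_of_write {x : Var} {v : Val} (h : r.act s i = Act.write x v)
    (hst : s < t) : (r.writes i s).length < (r.writes i t).length :=
  lt_of_lt_of_le (by simp [writes, h, GState.newItems]) (writes_prefix r i hst).length_le

theorem exists_write_of_lt_length_writes (h : k < (r.writes i t).length) :
    ∃ s < t, (∃ x v, r.act s i = Act.write x v) ∧ (r.writes i s).length = k := by
  induction t with
  | zero => exact absurd h (Nat.not_lt_zero k)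
  | succ t ih =>
    by_cases hk : k < (r.writes i t).length
    · obtain ⟨s, hst, hs⟩ := ih hk
      exact ⟨s, hst.trans (Nat.lt_succ_self t), hs⟩
    · refine ⟨t, Nat.lt_succ_self t, ?_⟩
      rw [writes, List.length_append] at h
      cases ha : r.act t i <;> simp only [ha, GState.newItems, List.length_cons,
        List.length_nil] at h
      case write x v => exact ⟨⟨x, v, rfl⟩, by omega⟩
      all_goals omega

theorem propCount_succ_of_prop (h : r.prop t i) :
    r.propCount i (t + 1) = r.propCount i t + 1 := by simp [propCount, h]

theorem propCount_succ_of_not_prop (h : ¬ r.prop t i) :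
    r.propCount i (t + 1) = r.propCount i t := by simp [propCount, h]

theorem propCount_mono (r : Run n Var Val Lbl V) (i : Fin n) : Monotone (r.propCount i) :=
  monotone_nat_of_le_succ fun _ => Nat.le_add_right _ _

theorem propCount_lt_of_prop (h : r.prop s i) (hst : s < t) :
    r.propCount i s < r.propCount i t :=
  lt_of_lt_of_le (by rw [propCount_succ_of_prop h]; exact Nat.lt_succ_self _)
    (propCount_mono r i hst)

theorem exists_prop_of_lt_propCount (h : k < r.propCount i t) :
    ∃ s < t, r.prop s i ∧ r.propCount i s = k := by
  induction t with
  | zero => exact absurd h (Nat.not_lt_zero k)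
  | succ t ih =>
    by_cases hk : k < r.propCount i t
    · obtain ⟨s, hst, hs⟩ := ih hk
      exact ⟨s, hst.trans (Nat.lt_succ_self t), hs⟩
    · by_cases hp : r.prop t i
      · rw [propCount_succ_of_prop hp] at h
        exact ⟨t, Nat.lt_succ_self t, hp, by omega⟩
      · exact absurd (propCount_succ_of_not_prop hp ▸ h) hk

variable [DecidableEq Var] {I : RegImpl n Var Val Lbl V} {it : Item Var Val}

theorem IsRunOf.length_writes (hr : r.IsRunOf I) (i : Fin n) (t : ℕ) :
    (r.writes i t).length = writeCount ((r.state t).loc i) := by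
  induction t with
  | zero => simp [writes, hr.init_loc, writeCount]
  | succ t ih =>
    rw [(hr.transition t).loc, writeCount_append, writeCount_append, GState.writeCount_record, ← ih]
    cases r.inv t i <;> simp [writes, writeCount]

theorem IsRunOf.propCount_le_and_buf_eq (hr : r.IsRunOf I) (i : Fin n) (t : ℕ) :
    r.propCount i t ≤ (r.writes i t).length ∧
      (r.state t).buf i = (r.writes i t).drop (r.propCount i t) := by
  induction t with
  | zero => simp [writes, propCount, hr.init_buf]
  | succ t ih =>
    obtain ⟨hle, hbuf⟩ := ih
    by_cases hp : r.prop t i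
    · have hlt : r.propCount i t < (r.writes i t).length := by
        simpa [hbuf] using hr.enabled_prop t i hp
      rw [(hr.transition t).buf_prop i hp, hbuf, propCount_succ_of_prop hp, writes,
        ← List.drop_append_of_le_length hle, List.tail_drop, List.length_append]
      exact ⟨by omega, rfl⟩
    · rw [(hr.transition t).buf_idle i hp, hbuf, propCount_succ_of_not_prop hp, writes,
        ← List.drop_append_of_le_length hle, List.length_append]
      exact ⟨by omega, rfl⟩

theorem IsRunOf.buf_eq (hr : r.IsRunOf I) (i : Fin n) (t : ℕ) :
    (r.state t).buf i = (r.writes i t).drop (r.propCount i t) :=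
  (hr.propCount_le_and_buf_eq i t).2

theorem IsRunOf.propCount_lt_length_writes (hr : r.IsRunOf I) (h : r.prop t i) :
    r.propCount i t < (r.writes i t).length := by
  simpa [hr.buf_eq] using hr.enabled_prop t i h

theorem IsRunOf.exists_isProp (hr : r.IsRunOf I) (h : r.prop t i) : ∃ it, r.IsProp i t it :=
  ⟨_, h, List.head?_eq_some_head (hr.enabled_prop t i h)⟩

theorem IsRunOf.idx_of_getElem?_writes (hr : r.IsRunOf I) (h : (r.writes i t)[k]? = some it) :
    it.idx = k + 1 := by
  induction t with
  | zero => simp [writes] at h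
  | succ t ih =>
    rw [writes, List.getElem?_append] at h
    split at h
    · exact ih h
    · cases ha : r.act t i <;> simp only [ha, GState.newItems, List.getElem?_nil, reduceCtorEq,
        List.getElem?_singleton, Option.ite_none_right_eq_some, Option.some.injEq] at h
      obtain ⟨hk, rfl⟩ := h
      simp only [← hr.length_writes]
      omega

theorem IsRunOf.getElem?_writes_of_isProp (hr : r.IsRunOf I) (h : r.IsProp i t it)
    (hs : r.propCount i t < (r.writes i s).length) :
    (r.writes i s)[r.propCount i t]? = some it := by
  rw [getElem?_writes_eq hs (hr.propCount_lt_length_writes h.1), ← List.head?_drop, ← hr.buf_eq,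
    h.2]

theorem IsRunOf.drop_propCount_of_isProp (hr : r.IsRunOf I) (h : r.IsProp i t it)
    (hs : r.propCount i t < (r.writes i s).length) :
    (r.writes i s).drop (r.propCount i t) = it :: (r.writes i s).drop (r.propCount i (t + 1)) := by
  have hget := hr.getElem?_writes_of_isProp h hs
  rw [List.getElem?_eq_getElem hs] at hget
  rw [List.drop_eq_getElem_cons hs, Option.some.inj hget, propCount_succ_of_prop h.1]

theorem IsRunOf.propTag (hr : r.IsRunOf I) (h : r.prop t i) :
    r.PropTag i t (r.propCount i t + 1) := by
  obtain ⟨it, hp⟩ := hr.exists_isProp h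
  exact ⟨it, hp, (hr.idx_of_getElem?_writes
    (hr.getElem?_writes_of_isProp hp (hr.propCount_lt_length_writes h))).symm⟩

end Buffers

/-! ### Memory writes -/

section MemWrite

variable {n : ℕ} {Var Val Lbl V : Type*}

/-- The action at the node changes the variable `x` in memory: it is a read-modify-write of `x` or
a propagation of an entry for `x`. -/
def MemWrite (r : Run n Var Val Lbl V) (x : Var) : Node n → Prop
  | (Agent.proc i, t) => r.IsRMW i t x
  | (Agent.disp i, t) => ∃ it, r.IsProp i t it ∧ it.var = x

variable [DecidableEq Var] {r : Run n Var Val Lbl V} {I : RegImpl n Var Val Lbl V}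
  {x : Var} {i : Fin n} {b c : Agent n} {s t u : ℕ}

theorem MemWrite.memAccess {θ : Node n} (h : r.MemWrite x θ) : r.MemAccess x θ := by
  obtain ⟨i | i, t⟩ := θ
  · exact Or.inr h
  · exact h

theorem MemWrite.not_nodeRfM {θ : Node n} (h : r.MemWrite x θ) : ¬ r.NodeRfM θ := by
  obtain ⟨i | i, t⟩ := θ
  · obtain ⟨e, w, hrmw⟩ := h
    rintro ⟨y, hread, -⟩
    exact absurd (hread.symm.trans hrmw) (by simp)
  · exact id

theorem MemWrite.ob (h : r.MemWrite x (b, s)) (h' : r.MemWrite x (c, t)) (hst : s < t) :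
    r.OB (b, s) (c, t) :=
  .access b c s t x hst h.memAccess h'.memAccess (fun H => h.not_nodeRfM H.1)
    fun ⟨_, _, _, H⟩ => h'.not_nodeRfM H

theorem MemWrite.ob_of_isRfM (h : r.MemWrite x (b, s)) (h' : r.IsRfM i t x) (hst : s < t)
    (hb : b ≠ Agent.disp i) : r.OB (b, s) (Agent.proc i, t) :=
  .access _ _ _ _ x hst h.memAccess (Or.inl h') (fun H => h.not_nodeRfM H.1)
    fun ⟨_, hbj, hij, _⟩ => by cases hij; exact hb hbj

theorem IsRfM.ob_of_memWrite (h : r.IsRfM i s x) (h' : r.MemWrite x (b, t)) (hst : s < t) :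
    r.OB (Agent.proc i, s) (b, t) :=
  .access _ _ _ _ x hst (Or.inl h) h'.memAccess (fun H => h'.not_nodeRfM H.2)
    fun ⟨_, H, _⟩ => by cases H

theorem IsRunOf.eq_of_memWrite (hr : r.IsRunOf I) (h : r.MemWrite x (b, t))
    (h' : r.MemWrite x (c, t)) : b = c := by
  by_contra hne
  refine hr.no_conflict t b c hne ⟨fun H => h.not_nodeRfM H.1, ⟨x, h.memAccess, h'.memAccess⟩, ?_⟩
  rintro ⟨j, ⟨-, -, H⟩ | ⟨-, -, H⟩⟩
  · exact h'.not_nodeRfM H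
  · exact h.not_nodeRfM H

theorem IsRunOf.not_memWrite_of_isRfM (hr : r.IsRunOf I) (h : r.IsRfM i t x) (b : Agent n) :
    ¬ r.MemWrite x (b, t) := by
  intro hw
  have hne : b ≠ Agent.proc i := by
    rintro rfl
    exact hw.not_nodeRfM ⟨x, h⟩
  refine hr.no_conflict t b (Agent.proc i) hne
    ⟨fun H => hw.not_nodeRfM H.1, ⟨x, hw.memAccess, Or.inl h⟩, ?_⟩
  rintro ⟨j, ⟨rfl, hj, -⟩ | ⟨hj, -⟩⟩
  · cases hj
    obtain ⟨it, hp, hx⟩ := hw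
    exact lastItem_eq_none.1 h.2 it (List.mem_of_mem_head? hp.2) hx
  · cases hj

theorem Transition.mem_eq (h : r.Transition t) (hx : ∀ b, ¬ r.MemWrite x (b, t)) :
    (r.state (t + 1)).mem x = (r.state t).mem x :=
  h.mem_idle x (fun i => hx (Agent.proc i)) fun i it hp hv => hx (Agent.disp i) ⟨it, hp, hv⟩

theorem IsRunOf.mem_eq (hr : r.IsRunOf I) (hst : s ≤ t)
    (hx : ∀ b u, s ≤ u → u < t → ¬ r.MemWrite x (b, u)) :
    (r.state t).mem x = (r.state s).mem x := by
  induction t, hst using Nat.le_induction with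
  | base => rfl
  | succ t hst ih =>
    rw [(hr.transition t).mem_eq fun b => hx b t hst (Nat.lt_succ_self t)]
    exact ih fun b u hsu hut => hx b u hsu (hut.trans (Nat.lt_succ_self t))

theorem IsRunOf.lastItem_drop_propCount_succ (hr : r.IsRunOf I) (htu : t ≤ u)
    (hx : ¬ r.MemWrite x (Agent.disp i, t)) :
    lastItem ((r.writes i u).drop (r.propCount i (t + 1))) x =
      lastItem ((r.writes i u).drop (r.propCount i t)) x := by
  by_cases h : r.prop t i
  · obtain ⟨it, hp⟩ := hr.exists_isProp h
    rw [hr.drop_propCount_of_isProp hp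
        ((hr.propCount_lt_length_writes h).trans_le (writes_prefix r i htu).length_le),
      lastItem_cons, if_neg fun hv => hx ⟨it, hp, hv⟩, Option.or_none]
  · rw [propCount_succ_of_not_prop h]

theorem IsRunOf.lastItem_drop_propCount_eq (hr : r.IsRunOf I) (hst : s ≤ t) (htu : t ≤ u)
    (hx : ∀ z, s ≤ z → z < t → ¬ r.MemWrite x (Agent.disp i, z)) :
    lastItem ((r.writes i u).drop (r.propCount i t)) x =
      lastItem ((r.writes i u).drop (r.propCount i s)) x := by
  induction t, hst using Nat.le_induction with
  | base => rfl
  | succ t hst ih =>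
    rw [hr.lastItem_drop_propCount_succ (by omega) (hx t hst (Nat.lt_succ_self t))]
    exact ih (by omega) fun z hsz hzt => hx z hsz (by omega)

/-- The value of `x` as seen by process `i` when it has made its writes before time `u`, while its
dispatcher and the memory have advanced to time `t`. -/
noncomputable def view (r : Run n Var Val Lbl V) (i : Fin n) (x : Var) (u t : ℕ) : Val :=
  (lastItem ((r.writes i u).drop (r.propCount i t)) x).elim ((r.state t).mem x) Item.val

theorem IsRunOf.readVal_eq_view (hr : r.IsRunOf I) :
    (r.state t).readVal i x = r.view i x t t := by
  rw [GState.readVal_eq, hr.buf_eq, view]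

theorem IsRunOf.view_succ (hr : r.IsRunOf I) (htu : t ≤ u)
    (hx : ∀ b, r.MemWrite x (b, t) → b = Agent.disp i) :
    r.view i x u (t + 1) = r.view i x u t := by
  by_cases hw : r.MemWrite x (Agent.disp i, t)
  · obtain ⟨it, hp, rfl⟩ := hw
    rw [view, view, hr.drop_propCount_of_isProp hp
        ((hr.propCount_lt_length_writes hp.1).trans_le (writes_prefix r i htu).length_le),
      lastItem_cons, if_pos rfl, (hr.transition t).mem_prop i it hp]
    cases lastItem ((r.writes i u).drop (r.propCount i (t + 1))) it.var <;> rfl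
  · rw [view, view, hr.lastItem_drop_propCount_succ htu hw,
      (hr.transition t).mem_eq fun b hb => hw (hx b hb ▸ hb)]

theorem IsRunOf.view_eq (hr : r.IsRunOf I) (hst : s ≤ t) (htu : t ≤ u)
    (hx : ∀ b z, s ≤ z → z < t → r.MemWrite x (b, z) → b = Agent.disp i) :
    r.view i x u t = r.view i x u s := by
  induction t, hst using Nat.le_induction with
  | base => rfl
  | succ t hst ih =>
    rw [hr.view_succ (by omega) fun b => hx b t hst (Nat.lt_succ_self t)]
    exact ih (by omega) fun b z hsz hzt => hx b z hsz (by omega)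

end MemWrite

/-! ### Consistent cuts -/

section Cuts

variable {n : ℕ} {Var Val Lbl V : Type*} [DecidableEq Var] {r : Run n Var Val Lbl V}
  {I : RegImpl n Var Val Lbl V} {p q : Agent n → ℕ} {x : Var} {m : ℕ}

theorem OB.lt {θ η : Node n} (h : r.OB θ η) : θ.2 < η.2 := by
  induction h with
  | trans _ _ _ _ _ h h' => exact h.trans h'
  | _ => assumption

/-- The set of the nodes `⟨b, t⟩` with `t < p b` is a consistent cut of `r`: it is bounded in time
and contains, with a node, every node that occurs before it. -/
structure IsCut (r : Run n Var Val Lbl V) (p : Agent n → ℕ) : Prop where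
  closed : ∀ b u c u', r.OB (b, u) (c, u') → u' < p c → u < p b
  bounded : ∃ T, ∀ b, p b ≤ T

theorem isCut_const (r : Run n Var Val Lbl V) (t : ℕ) : r.IsCut fun _ => t :=
  ⟨fun _ _ _ _ h hu => h.lt.trans hu, t, fun _ => le_rfl⟩

theorem IsCut.min (hp : r.IsCut p) (hq : r.IsCut q) : r.IsCut fun b => min (p b) (q b) where
  closed b u c u' h hu := lt_min (hp.closed b u c u' h (lt_min_iff.1 hu).1)
    (hq.closed b u c u' h (lt_min_iff.1 hu).2)
  bounded := hp.bounded.imp fun _ hT b => (min_le_left _ _).trans (hT b)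

theorem IsCut.max (hp : r.IsCut p) (hq : r.IsCut q) : r.IsCut fun b => max (p b) (q b) where
  closed b u c u' h hu := lt_max_iff.2
    ((lt_max_iff.1 hu).imp (hp.closed b u c u' h) (hq.closed b u c u' h))
  bounded := by
    obtain ⟨T, hT⟩ := hp.bounded
    obtain ⟨T', hT'⟩ := hq.bounded
    exact ⟨T ⊔ T', fun b => max_le_max (hT b) (hT' b)⟩

theorem exists_isCut_of_node (r : Run n Var Val Lbl V) (θ : Node n) (T : ℕ) :
    ∃ τ : Agent n → ℕ, r.IsCut τ ∧ (∀ b, τ b ≤ T) ∧ τ θ.1 ≤ θ.2 ∧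
      ∀ b, ¬ (θ = (b, T) ∨ r.OB θ (b, T)) → τ b = T := by
  classical
  set F : Set (Node n) := {η | θ = η ∨ r.OB θ η}
  have hup : ∀ η ζ, η ∈ F → r.OB η ζ → ζ ∈ F := by
    rintro η ζ (rfl | h) h'
    · exact Or.inr h'
    · exact Or.inr (h.trans _ _ _ h')
  have hmono : ∀ b u t, u ≤ t → (b, u) ∈ F → (b, t) ∈ F := fun b u t hut hu =>
    hut.eq_or_lt.elim (fun h => h ▸ hu) fun h => hup _ _ hu (.locality b u t h)
  have hex : ∀ b, ∃ t, t = T ∨ (b, t) ∈ F := fun b => ⟨T, Or.inl rfl⟩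
  have hlt : ∀ b t, t < Nat.find (hex b) ↔ t < T ∧ (b, t) ∉ F := by
    intro b t
    rw [Nat.lt_find_iff]
    refine ⟨fun h => ⟨?_, fun ht => h t le_rfl (Or.inr ht)⟩, ?_⟩
    · by_contra! hTt
      exact h T hTt (Or.inl rfl)
    · rintro ⟨htT, ht⟩ u hut (rfl | hu)
      · omega
      · exact ht (hmono b u t hut hu)
  have hle : ∀ b, Nat.find (hex b) ≤ T := fun b => Nat.find_min' _ (Or.inl rfl)
  refine ⟨fun b => Nat.find (hex b), ⟨fun b u c u' h hu => ?_, T, hle⟩, hle,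
    Nat.find_min' _ (Or.inr (Or.inl rfl)), fun b hb => ?_⟩
  · obtain ⟨huT, hu⟩ := (hlt c u').1 hu
    exact (hlt b u).2 ⟨h.lt.trans huT, fun h' => hu (hup _ _ h' h)⟩
  · exact eq_of_forall_lt_iff fun t =>
      (hlt b t).trans (and_iff_left_of_imp fun ht h => hb (hmono b t T ht.le h))

theorem IsCut.propCount_le (hr : r.IsRunOf I) (hp : r.IsCut p) (i : Fin n) :
    r.propCount i (p (Agent.disp i)) ≤ (r.writes i (p (Agent.proc i))).length := by
  by_contra! hlt
  obtain ⟨u, hu, hprop, hcount⟩ := exists_prop_of_lt_propCount hlt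
  obtain ⟨s, hsu, ⟨x, v, hact⟩, hlen⟩ :=
    exists_write_of_lt_length_writes (hr.propCount_lt_length_writes hprop)
  have hob : r.OB (Agent.proc i, s) (Agent.disp i, u) :=
    .buffer i s u (r.propCount i u + 1) hsu
      (Or.inl ⟨x, v, hact, by rw [← hr.length_writes, hlen]⟩) (hr.propTag hprop)
  have := length_writes_lt_of_write hact (hp.closed _ _ _ _ hob hu)
  omega

/-- The memory writes of `x` in the cut `p` are those before time `m`. -/
def SplitsAt (r : Run n Var Val Lbl V) (p : Agent n → ℕ) (x : Var) (m : ℕ) : Prop :=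
  ∀ b u, r.MemWrite x (b, u) → (u < p b ↔ u < m)

-- The memory writes of `x` are totally ordered by occurs-before.
theorem IsRunOf.exists_splitsAt (hr : r.IsRunOf I) (hp : r.IsCut p) (x : Var) :
    ∃ m, r.SplitsAt p x m := by
  classical
  by_cases h : ∃ u b, r.MemWrite x (b, u) ∧ p b ≤ u
  · obtain ⟨c, hc, hpc⟩ := Nat.find_spec h
    refine ⟨Nat.find h, fun b u hw => ⟨fun hu => ?_, fun hu => ?_⟩⟩
    · by_contra! hle
      rcases hle.eq_or_lt with heq | hlt
      · rw [← heq] at hw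
        obtain rfl := hr.eq_of_memWrite hw hc
        omega
      · exact hpc.not_gt (hp.closed _ _ _ _ (hc.ob hw hlt) hu)
    · by_contra! hle
      exact Nat.find_min h hu ⟨b, hw, hle⟩
  · push Not at h
    obtain ⟨T, hT⟩ := hp.bounded
    exact ⟨T, fun b u hw => ⟨fun hu => hu.trans_le (hT b), fun _ => h u b hw⟩⟩

theorem SplitsAt.mem_eq {m' : ℕ} (hr : r.IsRunOf I) (h : r.SplitsAt p x m)
    (h' : r.SplitsAt p x m') : (r.state m).mem x = (r.state m').mem x := by
  wlog hle : m' ≤ m generalizing m m'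
  · exact (this h' h (le_of_not_ge hle)).symm
  exact hr.mem_eq hle fun b u hmu hum hw => hmu.not_gt ((h' b u hw).1 ((h b u hw).2 hum))

open Classical in
/-- The global state reached when exactly the nodes of the cut `p` have been executed.  In memory, a
variable has the value that it has in `r` at a time at which the memory writes executed in `r` are
those in `p`; the value `(r.state 0).mem x` is a dummy, as every cut of a run has such a time. -/
noncomputable def cutState (r : Run n Var Val Lbl V) (p : Agent n → ℕ) :
    GState n Var Val Lbl V where
  mem x := if h : ∃ m, r.SplitsAt p x m then (r.state h.choose).mem x else (r.state 0).mem x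
  buf i := (r.writes i (p (Agent.proc i))).drop (r.propCount i (p (Agent.disp i)))
  loc i := (r.state (p (Agent.proc i))).loc i

theorem SplitsAt.cutState_mem (hr : r.IsRunOf I) (h : r.SplitsAt p x m) :
    (r.cutState p).mem x = (r.state m).mem x := by
  have hex : ∃ m, r.SplitsAt p x m := ⟨m, h⟩
  simp only [cutState, dif_pos hex]
  exact hex.choose_spec.mem_eq hr h

theorem IsRunOf.cutState_const (hr : r.IsRunOf I) (t : ℕ) :
    r.cutState (fun _ => t) = r.state t := by
  have hmem : (r.cutState fun _ => t).mem = (r.state t).mem :=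
    funext fun x => SplitsAt.cutState_mem hr fun _ _ _ => Iff.rfl
  have hbuf : (r.cutState fun _ => t).buf = (r.state t).buf :=
    funext fun i => (hr.buf_eq i t).symm
  calc r.cutState (fun _ => t)
      = ⟨(r.cutState fun _ => t).mem, (r.cutState fun _ => t).buf, (r.state t).loc⟩ := rfl
    _ = r.state t := by rw [hmem, hbuf]

end Cuts

/-! ### Rescheduling a run -/

section Reschedule

variable {n : ℕ} {Var Val Lbl V : Type*} {r : Run n Var Val Lbl V} {x : Var} {i : Fin n}
  {c : ℕ → Agent n → ℕ} {ρ : ℕ → ℕ} {t u : ℕ}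

open Classical in
/-- The run that executes the nodes of `r` according to the sequence `c` of cuts; the agents that
advance at time `t` execute their nodes at time `ρ t` of `r`. -/
noncomputable def reschedule (r : Run n Var Val Lbl V) (c : ℕ → Agent n → ℕ) (ρ : ℕ → ℕ) :
    Run n Var Val Lbl V where
  state t := r.cutState (c t)
  act t i := if c (t + 1) (Agent.proc i) ≠ c t (Agent.proc i) then r.act (ρ t) i else Act.null
  prop t i := c (t + 1) (Agent.disp i) ≠ c t (Agent.disp i) ∧ r.prop (ρ t) i
  inv t i := if c (t + 1) (Agent.proc i) ≠ c t (Agent.proc i) then r.inv (ρ t) i else none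

theorem reschedule_act_of_ne (hi : c (t + 1) (Agent.proc i) ≠ c t (Agent.proc i)) :
    (r.reschedule c ρ).act t i = r.act (ρ t) i := if_pos hi

theorem reschedule_act_of_eq (hi : c (t + 1) (Agent.proc i) = c t (Agent.proc i)) :
    (r.reschedule c ρ).act t i = Act.null := if_neg (not_not_intro hi)

theorem reschedule_inv_of_ne (hi : c (t + 1) (Agent.proc i) ≠ c t (Agent.proc i)) :
    (r.reschedule c ρ).inv t i = r.inv (ρ t) i := if_pos hi

theorem reschedule_inv_of_eq (hi : c (t + 1) (Agent.proc i) = c t (Agent.proc i)) :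
    (r.reschedule c ρ).inv t i = none := if_neg (not_not_intro hi)

theorem isRMW_reschedule : (r.reschedule c ρ).IsRMW i t x ↔
    c (t + 1) (Agent.proc i) ≠ c t (Agent.proc i) ∧ r.IsRMW i (ρ t) x := by
  by_cases hi : c (t + 1) (Agent.proc i) = c t (Agent.proc i)
  · simp [IsRMW, reschedule_act_of_eq hi, hi]
  · simp [IsRMW, reschedule_act_of_ne hi, hi]

variable [DecidableEq Var] {I : RegImpl n Var Val Lbl V} {b : Agent n} {it : Item Var Val}
  {p p' : Agent n → ℕ}

/-- The cut `p'` results from `p` by executing the nodes at time `t` of some agents, namely of the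
agents `b` with `p' b ≠ p b`. -/
structure Advance (r : Run n Var Val Lbl V) (p p' : Agent n → ℕ) (t : ℕ) : Prop where
  isCut : r.IsCut p
  isCut' : r.IsCut p'
  step : ∀ b, p' b = p b ∨ p b = t ∧ p' b = t + 1

namespace Advance

theorem eq_of_ne (h : r.Advance p p' t) (hb : p' b ≠ p b) : p b = t :=
  ((h.step b).resolve_left hb).1

theorem eq_succ_of_ne (h : r.Advance p p' t) (hb : p' b ≠ p b) : p' b = t + 1 :=
  ((h.step b).resolve_left hb).2

theorem lt_of_lt (h : r.Advance p p' t) (hu : u < p' b) (hut : u ≠ t) : u < p b := by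
  have := h.step b
  omega

theorem splitsAt_of_memWrite (h : r.Advance p p' t) (hr : r.IsRunOf I) (hb : p' b ≠ p b)
    (hw : r.MemWrite x (b, t)) : r.SplitsAt p x t ∧ r.SplitsAt p' x (t + 1) := by
  have hpb := h.eq_of_ne hb
  have hpb' := h.eq_succ_of_ne hb
  have key : ∀ c u, r.MemWrite x (c, u) → (u < p c ↔ u < t) ∧ (u < p' c ↔ u < t + 1) := by
    intro c u hc
    have hstep := h.step c
    rcases lt_trichotomy u t with hu | rfl | hu
    · have := h.isCut'.closed _ _ _ _ (hc.ob hw hu) (by omega)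
      omega
    · obtain rfl := hr.eq_of_memWrite hc hw
      omega
    · have := h.isCut.closed _ _ _ _ (hw.ob hc hu)
      omega
  exact ⟨fun c u hc => (key c u hc).1, fun c u hc => (key c u hc).2⟩

theorem splitsAt_of_not_memWrite {m : ℕ} (h : r.Advance p p' t)
    (hx : ∀ b, p' b ≠ p b → ¬ r.MemWrite x (b, t)) (hm : r.SplitsAt p x m) :
    r.SplitsAt p' x m := by
  intro b u hw
  rw [← hm b u hw]
  by_cases hb : p' b = p b
  · rw [hb]
  · have hut : u ≠ t := fun hut => hx b hb (hut ▸ hw)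
    rw [h.eq_of_ne hb, h.eq_succ_of_ne hb]
    omega

theorem lt_of_isRfM (h : r.Advance p p' t) (hr : r.IsRunOf I)
    (hi : p' (Agent.proc i) ≠ p (Agent.proc i)) (hx : r.IsRfM i t x)
    (hw : r.MemWrite x (b, u)) (hu : u < p b) : u < t := by
  rcases lt_trichotomy u t with hut | rfl | htu
  · exact hut
  · exact (hr.not_memWrite_of_isRfM hx b hw).elim
  · have := h.isCut.closed _ _ _ _ (hx.ob_of_memWrite hw htu) hu
    rw [h.eq_of_ne hi] at this
    exact (lt_irrefl t this).elim

theorem lt_cut_of_isRfM (h : r.Advance p p' t) (hi : p' (Agent.proc i) ≠ p (Agent.proc i))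
    (hx : r.IsRfM i t x) (hw : r.MemWrite x (b, u)) (hu : u < t) (hb : b ≠ Agent.disp i) :
    u < p b := by
  refine h.lt_of_lt (h.isCut'.closed _ _ _ _ (hw.ob_of_isRfM hx hu hb) ?_) hu.ne
  rw [h.eq_succ_of_ne hi]
  exact Nat.lt_succ_self t

theorem exists_splitsAt_of_isRfM (h : r.Advance p p' t) (hr : r.IsRunOf I)
    (hi : p' (Agent.proc i) ≠ p (Agent.proc i)) (hx : r.IsRfM i t x) :
    ∃ m, r.SplitsAt p x m ∧ min (p (Agent.disp i)) t ≤ m ∧ m ≤ t := by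
  obtain ⟨m, hm⟩ := hr.exists_splitsAt h.isCut x
  refine ⟨max (min m t) (min (p (Agent.disp i)) t), fun b u hw => ⟨fun hu => ?_, fun hu => ?_⟩,
    le_max_right _ _, max_le (min_le_right _ _) (min_le_right _ _)⟩
  · exact lt_max_of_lt_left (lt_min ((hm b u hw).1 hu) (h.lt_of_isRfM hr hi hx hw hu))
  · rcases lt_max_iff.1 hu with hu | hu
    · exact (hm b u hw).2 (lt_min_iff.1 hu).1
    · by_cases hb : b = Agent.disp i
      · exact hb ▸ (lt_min_iff.1 hu).1
      · exact h.lt_cut_of_isRfM hi hx hw (lt_min_iff.1 hu).2 hb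

theorem readVal_of_isRfM (h : r.Advance p p' t) (hr : r.IsRunOf I)
    (hi : p' (Agent.proc i) ≠ p (Agent.proc i)) (hx : r.IsRfM i t x) :
    (r.cutState p).readVal i x = (r.state t).readVal i x := by
  obtain ⟨m, hm, hdm, hmt⟩ := h.exists_splitsAt_of_isRfM hr hi hx
  have hview : r.view i x t t = r.view i x t m := by
    refine hr.view_eq hmt le_rfl fun b z hmz hzt hw => ?_
    by_contra hb
    exact hmz.not_gt ((hm b z hw).1 (h.lt_cut_of_isRfM hi hx hw hzt hb))
  have hlast : lastItem ((r.writes i t).drop (r.propCount i (p (Agent.disp i)))) x =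
      lastItem ((r.writes i t).drop (r.propCount i m)) x := by
    rcases le_or_gt (p (Agent.disp i)) m with hd | hd
    · exact (hr.lastItem_drop_propCount_eq hd hmt fun z hdz hzm hw =>
        hdz.not_gt ((hm _ z hw).2 hzm)).symm
    · obtain rfl : m = t := by omega
      have hnone := hx.2
      rw [hr.buf_eq] at hnone
      rw [hnone, lastItem_drop_eq_none_of_le (propCount_mono r i hd.le) hnone]
  rw [hr.readVal_eq_view, hview, view, GState.readVal_eq, hm.cutState_mem hr, ← hlast]
  simp only [cutState, h.eq_of_ne hi]

theorem lastItem_buf_of_read (h : r.Advance p p' t) (hr : r.IsRunOf I)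
    (hrace : r.NoReadPropRace) (hi : p' (Agent.proc i) ≠ p (Agent.proc i))
    (hact : r.act t i = Act.read x) (hit : lastItem ((r.state t).buf i) x = some it) :
    lastItem ((r.cutState p).buf i) x = some it := by
  have hrfb : r.IsRfB i t it := ⟨x, hact, hit⟩
  rw [hr.buf_eq] at hit
  obtain ⟨k, hk, hget, hlast⟩ := exists_getElem?_of_lastItem_drop hit
  simp only [cutState, h.eq_of_ne hi]
  refine hlast _ (le_of_not_gt fun hlt => ?_)
  obtain ⟨u, hu, hprop, rfl⟩ := exists_prop_of_lt_propCount hlt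
  have htu : t ≤ u := le_of_not_gt fun hut => hk.not_gt (propCount_lt_of_prop hprop hut)
  rcases htu.eq_or_lt with rfl | htu
  · obtain ⟨it', hp⟩ := hr.exists_isProp hprop
    have hit' := hr.getElem?_writes_of_isProp hp (hr.propCount_lt_length_writes hprop)
    obtain rfl : it = it' := Option.some.inj (hget.symm.trans hit')
    exact hrace i t it ⟨hrfb, hp⟩
  · have hob : r.OB (Agent.proc i, t) (Agent.disp i, u) :=
      .buffer i t u _ htu (Or.inr ⟨it, hrfb, (hr.idx_of_getElem?_writes hget).symm⟩)
        (hr.propTag hprop)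
    have := h.isCut.closed _ _ _ _ hob hu
    rw [h.eq_of_ne hi] at this
    exact lt_irrefl t this

theorem buf_eq_nil_of_sync (h : r.Advance p p' t) (hr : r.IsRunOf I)
    (hi : p' (Agent.proc i) ≠ p (Agent.proc i))
    (hsync : r.act t i = Act.fence ∨ ∃ x, r.IsRMW i t x) (hbuf : (r.state t).buf i = []) :
    (r.cutState p).buf i = [] := by
  rw [hr.buf_eq, List.drop_eq_nil_iff] at hbuf
  simp only [cutState, List.drop_eq_nil_iff, h.eq_of_ne hi]
  refine hbuf.trans (le_of_not_gt fun hlt => ?_)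
  obtain ⟨u, hut, hprop, hcount⟩ := exists_prop_of_lt_propCount hlt
  have hu : u < p (Agent.disp i) := by
    refine h.lt_of_lt (h.isCut'.closed _ _ _ _ (.sync i u t hut hprop hsync) ?_) hut.ne
    rw [h.eq_succ_of_ne hi]
    exact Nat.lt_succ_self t
  exact (propCount_lt_of_prop hprop hu).ne hcount

theorem enabled (h : r.Advance p p' t) (hr : r.IsRunOf I)
    (hi : p' (Agent.proc i) ≠ p (Agent.proc i)) : (r.cutState p).Enabled i (r.act t i) := by
  have hen := hr.enabled_act t i
  cases ha : r.act t i with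
  | fence =>
    rw [ha] at hen
    exact h.buf_eq_nil_of_sync hr hi (Or.inl ha) hen
  | rmw x e w =>
    rw [ha] at hen
    have hw : r.MemWrite x (Agent.proc i, t) := ⟨e, w, ha⟩
    exact ⟨h.buf_eq_nil_of_sync hr hi (Or.inr ⟨x, hw⟩) hen.1,
      ((h.splitsAt_of_memWrite hr hi hw).1.cutState_mem hr).trans hen.2⟩
  | _ => trivial

theorem record_eq (h : r.Advance p p' t) (hr : r.IsRunOf I) (hrace : r.NoReadPropRace)
    (hi : p' (Agent.proc i) ≠ p (Agent.proc i)) :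
    (r.cutState p).record i (r.act t i) = (r.state t).record i (r.act t i) := by
  cases ha : r.act t i with
  | read x =>
    simp only [GState.record]
    congr 2
    cases hl : lastItem ((r.state t).buf i) x with
    | none => exact h.readVal_of_isRfM hr hi ⟨ha, hl⟩
    | some it =>
      rw [GState.readVal_eq, GState.readVal_eq, hl, h.lastItem_buf_of_read hr hrace hi ha hl]
      rfl
  | _ => rfl

theorem writes_eq (h : r.Advance p p' t) (hi : p' (Agent.proc i) ≠ p (Agent.proc i)) :
    r.writes i (p' (Agent.proc i)) =
      r.writes i (p (Agent.proc i)) ++ (r.cutState p).newItems i (r.act t i) := by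
  rw [h.eq_of_ne hi, h.eq_succ_of_ne hi, writes]
  cases ha : r.act t i <;> simp only [GState.newItems, cutState, h.eq_of_ne hi]

theorem propCount_lt (h : r.Advance p p' t) (hr : r.IsRunOf I)
    (hi : p' (Agent.disp i) ≠ p (Agent.disp i)) (hprop : r.prop t i) :
    r.propCount i t < (r.writes i (p (Agent.proc i))).length := by
  rcases h.step (Agent.proc i) with hproc | ⟨hproc, -⟩
  · have := h.isCut'.propCount_le hr i
    rwa [h.eq_succ_of_ne hi, hproc, propCount_succ_of_prop hprop] at this
  · rw [hproc]
    exact hr.propCount_lt_length_writes hprop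

theorem head?_buf (h : r.Advance p p' t) (hr : r.IsRunOf I)
    (hi : p' (Agent.disp i) ≠ p (Agent.disp i)) (hprop : r.prop t i) :
    ((r.cutState p).buf i).head? = ((r.state t).buf i).head? := by
  obtain ⟨it, hp⟩ := hr.exists_isProp hprop
  rw [hp.2]
  simp only [cutState, List.head?_drop, h.eq_of_ne hi]
  exact hr.getElem?_writes_of_isProp hp (h.propCount_lt hr hi hprop)

theorem isProp_reschedule (h : r.Advance (c t) (c (t + 1)) (ρ t)) (hr : r.IsRunOf I) :
    (r.reschedule c ρ).IsProp i t it ↔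
      c (t + 1) (Agent.disp i) ≠ c t (Agent.disp i) ∧ r.IsProp i (ρ t) it := by
  simp only [IsProp, reschedule]
  rw [and_assoc]
  refine and_congr_right fun hi => and_congr_right fun hprop => ?_
  rw [h.head?_buf hr hi hprop]

theorem memWrite_reschedule (h : r.Advance (c t) (c (t + 1)) (ρ t)) (hr : r.IsRunOf I) :
    (r.reschedule c ρ).MemWrite x (b, t) ↔ c (t + 1) b ≠ c t b ∧ r.MemWrite x (b, ρ t) := by
  cases b with
  | proc i => exact isRMW_reschedule
  | disp i => simp only [MemWrite, h.isProp_reschedule hr, and_assoc, exists_and_left]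

theorem isRfM_of_reschedule (h : r.Advance (c t) (c (t + 1)) (ρ t)) (hr : r.IsRunOf I)
    (hrace : r.NoReadPropRace) (hx : (r.reschedule c ρ).IsRfM i t x) : r.IsRfM i (ρ t) x := by
  obtain ⟨hact, hnone⟩ := hx
  by_cases hi : c (t + 1) (Agent.proc i) = c t (Agent.proc i)
  · simp [reschedule_act_of_eq hi] at hact
  · rw [reschedule_act_of_ne hi] at hact
    refine ⟨hact, Option.eq_none_iff_forall_ne_some.2 fun it hit => ?_⟩
    exact absurd (hnone.symm.trans (h.lastItem_buf_of_read hr hrace hi hact hit)) (by simp)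

theorem memAccess_of_reschedule (h : r.Advance (c t) (c (t + 1)) (ρ t)) (hr : r.IsRunOf I)
    (hrace : r.NoReadPropRace) (hx : (r.reschedule c ρ).MemAccess x (b, t)) :
    r.MemAccess x (b, ρ t) ∧ (r.NodeRfM (b, ρ t) → (r.reschedule c ρ).NodeRfM (b, t)) := by
  cases b with
  | proc i =>
    rcases hx with hx | hx
    · exact ⟨Or.inl (h.isRfM_of_reschedule hr hrace hx), fun _ => ⟨x, hx⟩⟩
    · have hw : r.MemWrite x (Agent.proc i, ρ t) := (isRMW_reschedule.1 hx).2
      exact ⟨hw.memAccess, fun H => (hw.not_nodeRfM H).elim⟩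
  | disp i => exact ⟨((h.memWrite_reschedule hr (b := Agent.disp i)).1 hx).2, id⟩

theorem not_conflict_reschedule (h : r.Advance (c t) (c (t + 1)) (ρ t)) (hr : r.IsRunOf I)
    (hrace : r.NoReadPropRace) {b b' : Agent n} (hbb' : b ≠ b') :
    ¬ (r.reschedule c ρ).Conflict t b b' := by
  rintro ⟨hreads, ⟨x, hb, hb'⟩, hown⟩
  obtain ⟨hb, hbr⟩ := h.memAccess_of_reschedule hr hrace hb
  obtain ⟨hb', hbr'⟩ := h.memAccess_of_reschedule hr hrace hb'
  refine hr.no_conflict (ρ t) b b' hbb' ⟨fun H => hreads ⟨hbr H.1, hbr' H.2⟩, ⟨x, hb, hb'⟩,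
    fun ⟨i, H⟩ => hown ⟨i, ?_⟩⟩
  exact H.imp (fun ⟨hd, hp, H⟩ => ⟨hd, hp, hbr' H⟩) fun ⟨hd, hp, H⟩ => ⟨hd, hp, hbr H⟩

theorem loc_reschedule (h : r.Advance (c t) (c (t + 1)) (ρ t)) (hr : r.IsRunOf I)
    (hrace : r.NoReadPropRace) (i : Fin n) :
    (r.cutState (c (t + 1))).loc i =
      (r.cutState (c t)).loc i ++ (r.cutState (c t)).record i ((r.reschedule c ρ).act t i) ++
        (((r.reschedule c ρ).inv t i).map Rec.invoke).toList := by
  by_cases hi : c (t + 1) (Agent.proc i) = c t (Agent.proc i)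
  · simp [reschedule_act_of_eq hi, reschedule_inv_of_eq hi, hi, GState.record, cutState]
  · rw [reschedule_act_of_ne hi, reschedule_inv_of_ne hi, h.record_eq hr hrace hi]
    simp only [cutState, h.eq_of_ne hi, h.eq_succ_of_ne hi]
    exact (hr.transition _).loc i

theorem writes_reschedule (h : r.Advance (c t) (c (t + 1)) (ρ t)) (i : Fin n) :
    r.writes i (c (t + 1) (Agent.proc i)) = r.writes i (c t (Agent.proc i)) ++
      (r.cutState (c t)).newItems i ((r.reschedule c ρ).act t i) := by
  by_cases hi : c (t + 1) (Agent.proc i) = c t (Agent.proc i)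
  · simp [reschedule_act_of_eq hi, hi, GState.newItems]
  · rw [reschedule_act_of_ne hi, h.writes_eq hi]

theorem propCount_of_not_prop_reschedule (h : r.Advance (c t) (c (t + 1)) (ρ t))
    (hi : ¬ (r.reschedule c ρ).prop t i) :
    r.propCount i (c (t + 1) (Agent.disp i)) = r.propCount i (c t (Agent.disp i)) := by
  by_cases hd : c (t + 1) (Agent.disp i) = c t (Agent.disp i)
  · rw [hd]
  · rw [h.eq_of_ne hd, h.eq_succ_of_ne hd, propCount_succ_of_not_prop fun H => hi ⟨hd, H⟩]

theorem mem_of_memWrite_reschedule (h : r.Advance (c t) (c (t + 1)) (ρ t)) (hr : r.IsRunOf I)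
    (hw : (r.reschedule c ρ).MemWrite x (b, t)) :
    (r.cutState (c (t + 1))).mem x = (r.state (ρ t + 1)).mem x := by
  obtain ⟨hb, hw⟩ := (h.memWrite_reschedule hr).1 hw
  exact (h.splitsAt_of_memWrite hr hb hw).2.cutState_mem hr

theorem mem_of_not_memWrite_reschedule (h : r.Advance (c t) (c (t + 1)) (ρ t))
    (hr : r.IsRunOf I) (hx : ∀ b, ¬ (r.reschedule c ρ).MemWrite x (b, t)) :
    (r.cutState (c (t + 1))).mem x = (r.cutState (c t)).mem x := by
  obtain ⟨m, hm⟩ := hr.exists_splitsAt h.isCut x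
  have hm' := h.splitsAt_of_not_memWrite
    (fun b hb hw => hx b ((h.memWrite_reschedule hr).2 ⟨hb, hw⟩)) hm
  rw [hm.cutState_mem hr, hm'.cutState_mem hr]

theorem transition_reschedule (h : r.Advance (c t) (c (t + 1)) (ρ t)) (hr : r.IsRunOf I)
    (hrace : r.NoReadPropRace) : (r.reschedule c ρ).Transition t where
  loc := h.loc_reschedule hr hrace
  buf_prop i hp := by
    have hlt := h.propCount_lt hr hp.1 hp.2
    have hwrites := h.writes_reschedule i
    simp only [reschedule, cutState] at hwrites ⊢
    rw [hwrites, h.eq_of_ne hp.1, h.eq_succ_of_ne hp.1, propCount_succ_of_prop hp.2,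
      ← List.tail_drop, List.drop_append_of_le_length hlt.le]
  buf_idle i hp := by
    have hle := h.isCut.propCount_le hr i
    have hwrites := h.writes_reschedule i
    simp only [reschedule, cutState] at hwrites ⊢
    rw [hwrites, h.propCount_of_not_prop_reschedule hp, List.drop_append_of_le_length hle]
  mem_rmw i x e w ha := by
    have hw : (r.reschedule c ρ).MemWrite x (Agent.proc i, t) := ⟨e, w, ha⟩
    rw [reschedule_act_of_ne (isRMW_reschedule.1 hw).1] at ha
    exact (h.mem_of_memWrite_reschedule hr hw).trans ((hr.transition _).mem_rmw i x e w ha)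
  mem_prop i it hp := by
    have hw : (r.reschedule c ρ).MemWrite it.var (Agent.disp i, t) := ⟨it, hp, rfl⟩
    exact (h.mem_of_memWrite_reschedule hr hw).trans
      ((hr.transition _).mem_prop i it ((h.isProp_reschedule hr).1 hp).2)
  mem_idle x hrmw hprop := h.mem_of_not_memWrite_reschedule hr fun b hw => by
    cases b with
    | proc i => exact hrmw i hw
    | disp i => exact hw.elim fun it hit => hprop i it hit.1 hit.2

theorem validRound_reschedule (h : r.Advance (c t) (c (t + 1)) (ρ t)) (hr : r.IsRunOf I)
    (hrace : r.NoReadPropRace) : (r.reschedule c ρ).ValidRound I t where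
  enabled_act i := by
    by_cases hi : c (t + 1) (Agent.proc i) = c t (Agent.proc i)
    · rw [reschedule_act_of_eq hi]
      trivial
    · rw [reschedule_act_of_ne hi]
      exact h.enabled hr hi
  enabled_prop i hp := by
    simpa [reschedule, cutState, h.eq_of_ne hp.1] using h.propCount_lt hr hp.1 hp.2
  no_conflict _ _ := h.not_conflict_reschedule hr hrace
  transition := h.transition_reschedule hr hrace
  consistent i hne := by
    by_cases hi : c (t + 1) (Agent.proc i) = c t (Agent.proc i)
    · exact (hne (reschedule_act_of_eq hi)).elim
    · rw [reschedule_act_of_ne hi] at hne ⊢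
      simp only [reschedule, cutState, h.eq_of_ne hi]
      exact hr.consistent _ i hne

end Advance

theorem isRunOf_reschedule (hr : r.IsRunOf I) (hrace : r.NoReadPropRace) (h0 : c 0 = fun _ => 0)
    (h : ∀ t, r.Advance (c t) (c (t + 1)) (ρ t)) : (r.reschedule c ρ).IsRunOf I :=
  hr.of_validRound (by simp only [reschedule, h0, hr.cutState_const])
    fun t => (h t).validRound_reschedule hr hrace

end Reschedule

/-! ### Delaying the future of a node -/

section Delay

variable {n : ℕ} {Var Val Lbl V : Type*}

/-- The time to which the round at time `u` of a process moves if the process idles for `Δ` rounds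
from time `s` on. -/
def shift (s Δ u : ℕ) : ℕ := if u < s then u else u + Δ

theorem shift_lt_shift {s Δ u v : ℕ} : shift s Δ u < shift s Δ v ↔ u < v := by
  simp only [shift]
  split_ifs <;> omega

/-- The operation that corresponds to `X` if every process `i` idles for `Δ` rounds from time `s i`
on. -/
def shiftOp (s : Fin n → ℕ) (Δ : ℕ) (X : Op n) : Op n := (X.1, shift (s X.1) Δ X.2)

/-- For every process `i`, the behavior in `r` is that in `q` with `Δ` idle rounds inserted at
time `s i`. -/
structure InsertsIdle (q r : Run n Var Val Lbl V) (s : Fin n → ℕ) (Δ : ℕ) : Prop where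
  act_shift : ∀ i u, r.act (shift (s i) Δ u) i = q.act u i
  inv_shift : ∀ i u, r.inv (shift (s i) Δ u) i = q.inv u i
  idle : ∀ i u, s i ≤ u → u < s i + Δ → r.act u i = Act.null ∧ r.inv u i = none

namespace InsertsIdle

variable {q r : Run n Var Val Lbl V} {s : Fin n → ℕ} {Δ : ℕ} {X Y : Op n}

theorem inv_shiftOp (h : q.InsertsIdle r s Δ) (X : Op n) :
    r.inv (shiftOp s Δ X).2 (shiftOp s Δ X).1 = q.inv X.2 X.1 := h.inv_shift _ _

theorem isOp_shiftOp (h : q.InsertsIdle r s Δ) : r.IsOp (shiftOp s Δ X) ↔ q.IsOp X := by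
  rw [IsOp, IsOp, h.inv_shiftOp]

theorem eq_shift_or_idle (h : q.InsertsIdle r s Δ) (i : Fin n) (t : ℕ) :
    (∃ u, t = shift (s i) Δ u) ∨ r.act t i = Act.null ∧ r.inv t i = none := by
  rcases lt_or_ge t (s i) with hlt | hge
  · exact Or.inl ⟨t, (if_pos hlt).symm⟩
  rcases lt_or_ge t (s i + Δ) with hlt' | hge'
  · exact Or.inr (h.idle i t hge hlt')
  · refine Or.inl ⟨t - Δ, ?_⟩
    rw [shift, if_neg (by omega)]
    omega

theorem exists_shiftOp_eq (h : q.InsertsIdle r s Δ) (hX : r.IsOp X) : ∃ Z, shiftOp s Δ Z = X := by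
  obtain ⟨u, hu⟩ := (h.eq_shift_or_idle X.1 X.2).resolve_right fun H => hX H.2
  exact ⟨(X.1, u), Prod.ext rfl hu.symm⟩

theorem wellFormed {v₀ : V} (h : q.InsertsIdle r s Δ) (hq : q.WellFormed v₀) :
    r.WellFormed v₀ where
  sequential i t t' htt' ht ht' := by
    obtain ⟨u, rfl⟩ := (h.eq_shift_or_idle i t).resolve_right fun H => ht H.2
    obtain ⟨u', rfl⟩ := (h.eq_shift_or_idle i t').resolve_right fun H => ht' H.2
    obtain ⟨z, w, huz, hzu', hret⟩ := hq.sequential i u u' (shift_lt_shift.1 htt')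
      (h.isOp_shiftOp.1 ht) (h.isOp_shiftOp.1 ht')
    exact ⟨shift (s i) Δ z, w, shift_lt_shift.2 huz, shift_lt_shift.2 hzu',
      by rw [h.act_shift, hret]⟩
  unique_write X Y v hX hY := by
    obtain ⟨X, rfl⟩ := h.exists_shiftOp_eq (X := X) (by simp [IsOp, hX])
    obtain ⟨Y, rfl⟩ := h.exists_shiftOp_eq (X := Y) (by simp [IsOp, hY])
    rw [h.inv_shiftOp] at hX hY
    rw [hq.unique_write X Y v hX hY]
  default_not_written X hX := by
    obtain ⟨X, rfl⟩ := h.exists_shiftOp_eq (X := X) (by simp [IsOp, hX])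
    rw [h.inv_shiftOp] at hX
    exact hq.default_not_written X hX

theorem returns {z : ℕ} {w : RegResp V} (h : q.InsertsIdle r s Δ) (hX : q.Returns X (z + 1) w) :
    r.Returns (shiftOp s Δ X) (shift (s X.1) Δ z + 1) w := by
  obtain ⟨hop, z', hz, hXz, hret, hfirst⟩ := hX
  obtain rfl := Nat.succ.inj hz
  refine ⟨h.isOp_shiftOp.2 hop, _, rfl, shift_lt_shift.2 hXz, (h.act_shift _ _).trans hret,
    fun u w' hu hu' hact => ?_⟩
  rcases h.eq_shift_or_idle X.1 u with ⟨u, rfl⟩ | ⟨hnull, -⟩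
  · exact hfirst u w' (shift_lt_shift.1 hu) (shift_lt_shift.1 hu')
      ((h.act_shift _ _).symm.trans hact)
  · exact absurd (hact.symm.trans hnull) (by simp)

theorem completes (h : q.InsertsIdle r s Δ) (hX : q.Completes X) :
    r.Completes (shiftOp s Δ X) := by
  obtain ⟨_, w, hXe⟩ := hX
  obtain ⟨-, z, rfl, -⟩ := id hXe
  exact ⟨_, w, h.returns hXe⟩

theorem isValOp {v : V} (h : q.InsertsIdle r s Δ) (hX : q.IsValOp X v) :
    r.IsValOp (shiftOp s Δ X) v := by
  rcases hX with hX | ⟨hX, e, hXe⟩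
  · exact Or.inl ((h.inv_shiftOp X).trans hX)
  · obtain ⟨-, z, rfl, -⟩ := id hXe
    exact Or.inr ⟨(h.inv_shiftOp X).trans hX, _, h.returns hXe⟩

theorem precedes_shiftOp (h : q.InsertsIdle r s Δ) (hXY : q.Precedes X Y) (hY : s Y.1 ≤ Y.2) :
    r.Precedes (shiftOp s Δ X) (shiftOp s Δ Y) := by
  obtain ⟨hop, _, w, hXe, heY⟩ := hXY
  obtain ⟨-, z, rfl, -⟩ := id hXe
  refine ⟨h.isOp_shiftOp.2 hop, _, w, h.returns hXe, ?_⟩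
  simp only [shiftOp, shift]
  split_ifs <;> omega

theorem precedes_shiftOp_of_delayed {e : ℕ} {w : RegResp V} (h : q.InsertsIdle r s Δ)
    (hXe : q.Returns X e w) (he : e ≤ s X.1) (hYop : q.IsOp Y) (hY : s Y.1 ≤ Y.2)
    (hΔ : e < Y.2 + Δ) : r.Precedes (shiftOp s Δ X) (shiftOp s Δ Y) := by
  obtain ⟨-, z, rfl, -⟩ := id hXe
  refine ⟨h.isOp_shiftOp.2 hYop, _, w, h.returns hXe, ?_⟩
  simp only [shiftOp, shift]
  split_ifs <;> omega

end InsertsIdle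

/-- The cuts through which a run passes if it first executes, up to time `Δ`, the nodes in the cut
`τ`, and afterwards all others, delayed by `Δ`. -/
def delayCut (τ : Agent n → ℕ) (Δ t : ℕ) : Agent n → ℕ :=
  if t < Δ then fun b => min t (τ b) else fun b => max (t - Δ) (τ b)

/-- The time in the original run of the nodes that are executed at time `t` when the cuts
`delayCut τ Δ` are followed. -/
def delayClock (Δ t : ℕ) : ℕ := if t < Δ then t else t - Δ

variable {τ : Agent n → ℕ} {Δ T t : ℕ} {b : Agent n}

theorem delayCut_zero (hτΔ : ∀ b, τ b ≤ Δ) : delayCut τ Δ 0 = fun _ => 0 := by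
  funext b
  have := hτΔ b
  simp only [delayCut]
  split_ifs <;> simp only <;> omega

theorem delayCut_add (hτT : ∀ b, τ b ≤ T) : delayCut τ Δ (T + Δ) = fun _ => T := by
  funext b
  simp [delayCut, hτT b]

theorem delayCut_succ_ne_iff (hτΔ : τ b ≤ Δ) :
    delayCut τ Δ (t + 1) b ≠ delayCut τ Δ t b ↔ t < τ b ∨ τ b + Δ ≤ t := by
  simp only [delayCut]
  split_ifs <;> simp only <;> omega

theorem delayCut_shift_succ_ne (hτΔ : τ b ≤ Δ) (u : ℕ) :
    delayCut τ Δ (shift (τ b) Δ u + 1) b ≠ delayCut τ Δ (shift (τ b) Δ u) b := by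
  rw [delayCut_succ_ne_iff hτΔ, shift]
  split_ifs <;> omega

theorem delayClock_shift {s : ℕ} (hs : s ≤ Δ) (u : ℕ) : delayClock Δ (shift s Δ u) = u := by
  simp only [delayClock, shift]
  split_ifs <;> omega

variable [DecidableEq Var] {r q : Run n Var Val Lbl V} {I : RegImpl n Var Val Lbl V}

theorem isCut_delayCut (hτ : r.IsCut τ) (Δ t : ℕ) : r.IsCut (delayCut τ Δ t) := by
  unfold delayCut
  split_ifs
  · exact (r.isCut_const t).min hτ
  · exact (r.isCut_const (t - Δ)).max hτ

theorem advance_delayCut (hτ : r.IsCut τ) (hτΔ : ∀ b, τ b ≤ Δ) (t : ℕ) :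
    r.Advance (delayCut τ Δ t) (delayCut τ Δ (t + 1)) (delayClock Δ t) where
  isCut := isCut_delayCut hτ Δ t
  isCut' := isCut_delayCut hτ Δ (t + 1)
  step b := by
    have := hτΔ b
    simp only [delayCut, delayClock]
    split_ifs <;> simp only <;> omega

theorem exists_isRunOf_insertsIdle (hr : r.IsRunOf I) (hrace : r.NoReadPropRace)
    (hq : q.IsRunOf I) (hstate : q.state T = r.state T) (hact : ∀ t < T, q.act t = r.act t)
    (hinv : ∀ t < T, q.inv t = r.inv t) (hτ : r.IsCut τ) (hτT : ∀ b, τ b ≤ T) (hTΔ : T ≤ Δ) :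
    ∃ r' : Run n Var Val Lbl V, r'.IsRunOf I ∧
      q.InsertsIdle r' (fun i => τ (Agent.proc i)) Δ := by
  have hτΔ : ∀ b, τ b ≤ Δ := fun b => (hτT b).trans hTΔ
  set p := r.reschedule (delayCut τ Δ) (delayClock Δ) with hp
  have hrun : p.IsRunOf I :=
    isRunOf_reschedule hr hrace (delayCut_zero hτΔ) (advance_delayCut hτ hτΔ)
  have hend : p.state (T + Δ) = q.state T := by
    simp only [hp, reschedule, delayCut_add hτT, hr.cutState_const, hstate]
  have hearly : ∀ t < T + Δ, (p.glue (T + Δ) q T).SameRound p t t := fun t =>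
    sameRound_glue_of_lt hend
  have hlate : ∀ u, T ≤ u → (p.glue (T + Δ) q T).SameRound q (u + Δ) u := fun u hu => by
    have := sameRound_glue_of_le (p := p) (q := q) (B := T) (Nat.add_le_add_right hu Δ)
    rwa [Nat.add_sub_add_right, Nat.sub_add_cancel hu] at this
  have hshift : ∀ i u, (u < T ∧ shift (τ (Agent.proc i)) Δ u < T + Δ) ∨
      (T ≤ u ∧ shift (τ (Agent.proc i)) Δ u = u + Δ) := fun i u => by
    have := hτT (Agent.proc i)
    simp only [shift]
    split_ifs <;> omega
  refine ⟨p.glue (T + Δ) q T, hrun.glue (fun t _ => hq.validRound t) hend, fun i u => ?_,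
    fun i u => ?_, fun i u hu hu' => ?_⟩
  · rcases hshift i u with ⟨hu, hlt⟩ | ⟨hu, heq⟩
    · rw [(hearly _ hlt).act, reschedule_act_of_ne (delayCut_shift_succ_ne (hτΔ _) u),
        delayClock_shift (hτΔ _), hact u hu]
    · rw [heq, (hlate u hu).act]
  · rcases hshift i u with ⟨hu, hlt⟩ | ⟨hu, heq⟩
    · rw [(hearly _ hlt).inv, reschedule_inv_of_ne (delayCut_shift_succ_ne (hτΔ _) u),
        delayClock_shift (hτΔ _), hinv u hu]
    · rw [heq, (hlate u hu).inv]
  · have hi : delayCut τ Δ (u + 1) (Agent.proc i) = delayCut τ Δ u (Agent.proc i) :=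
      not_not.1 fun H => by have := (delayCut_succ_ne_iff (hτΔ _)).1 H; omega
    have hsame := hearly u (hu'.trans_le (Nat.add_le_add_right (hτT _) Δ))
    rw [hsame.act, hsame.inv]
    exact ⟨reschedule_act_of_eq hi, reschedule_inv_of_eq hi⟩

end Delay

/-! ### Linearizations -/

section Linearization

variable {n : ℕ} {Var Val Lbl V : Type*} {r : Run n Var Val Lbl V} {v₀ : V} {L : Set (Op n)}
  {pos : Op n → ℕ}

theorem Returns.start_lt {X : Op n} {e : ℕ} {w : RegResp V} (h : r.Returns X e w) : X.2 < e := by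
  obtain ⟨-, s, rfl, hs, -⟩ := h
  omega

theorem Returns.unique {X : Op n} {e e' : ℕ} {w w' : RegResp V} (h : r.Returns X e w)
    (h' : r.Returns X e' w') : e = e' ∧ w = w' := by
  obtain ⟨-, s, rfl, hXs, hret, hfirst⟩ := h
  obtain ⟨-, s', rfl, hXs', hret', hfirst'⟩ := h'
  obtain rfl : s = s' := by
    rcases lt_trichotomy s s' with hlt | heq | hlt
    · exact (hfirst' s w hXs hlt hret).elim
    · exact heq
    · exact (hfirst s' w' hXs' hlt hret').elim
  exact ⟨rfl, Act.ret.inj (hret.symm.trans hret')⟩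

theorem Precedes.completes {X Y : Op n} (h : r.Precedes X Y) : r.Completes X :=
  let ⟨_, e, w, he, _⟩ := h
  ⟨e, w, he⟩

theorem IsWriteOp.value_unique {W : Op n} {v v' : V} (h : r.IsWriteOp W v)
    (h' : r.IsWriteOp W v') : v = v' :=
  RegOp.write.inj (Option.some.inj (Eq.trans (Eq.symm h) h'))

/-- When the operations in `L` take effect in the order of their positions `pos`, the register
holds `v` just after position `k`. In contrast to `HoldsBefore`, a write at position `k` counts, so
that both the reads and the writes of `v` are at positions where the register holds `v`. -/
def HoldsAt (r : Run n Var Val Lbl V) (v₀ : V) (L : Set (Op n)) (pos : Op n → ℕ) (k : ℕ)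
    (v : V) : Prop :=
  (∃ W ∈ L, r.IsWriteOp W v ∧ pos W ≤ k ∧
    ∀ W' ∈ L, ∀ v', r.IsWriteOp W' v' → pos W' ≤ k → pos W' ≤ pos W) ∨
  (v = v₀ ∧ ∀ W ∈ L, ∀ v', r.IsWriteOp W v' → ¬ pos W ≤ k)

namespace HoldsAt

variable {k l m : ℕ} {v v' : V}

theorem unique (hinj : Set.InjOn pos L) (h : r.HoldsAt v₀ L pos k v)
    (h' : r.HoldsAt v₀ L pos k v') : v = v' := by
  rcases h with ⟨W, hWL, hW, hWk, hlast⟩ | ⟨rfl, hnone⟩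
  · rcases h' with ⟨W', hWL', hW', hWk', hlast'⟩ | ⟨-, hnone'⟩
    · obtain rfl := hinj hWL hWL'
        (le_antisymm (hlast' W hWL v hW hWk) (hlast W' hWL' v' hW' hWk'))
      exact hW.value_unique hW'
    · exact (hnone' W hWL v hW hWk).elim
  · rcases h' with ⟨W', hWL', hW', hWk', -⟩ | ⟨rfl, -⟩
    · exact (hnone W' hWL' v' hW' hWk').elim
    · rfl

theorem of_le (h : r.HoldsAt v₀ L pos k v) (hkl : k ≤ l)
    (hnew : ∀ W ∈ L, ∀ v', r.IsWriteOp W v' → pos W ≤ l → pos W ≤ k) :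
    r.HoldsAt v₀ L pos l v := by
  rcases h with ⟨W, hWL, hW, hWk, hlast⟩ | ⟨hv, hnone⟩
  · exact Or.inl ⟨W, hWL, hW, hWk.trans hkl, fun W' hWL' v' hW' hWl' =>
      hlast W' hWL' v' hW' (hnew W' hWL' v' hW' hWl')⟩
  · exact Or.inr ⟨hv, fun W hWL v' hW hWl => hnone W hWL v' hW (hnew W hWL v' hW hWl)⟩

theorem between (hwf : r.WellFormed v₀) (hk : r.HoldsAt v₀ L pos k v)
    (hl : r.HoldsAt v₀ L pos l v) (hkm : k ≤ m) (hml : m ≤ l) : r.HoldsAt v₀ L pos m v := by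
  refine hk.of_le hkm fun U hUL u hU hUm => ?_
  -- The register holds `v` at `l` through the same write as at `k`: no value is written twice.
  rcases hl with ⟨W, -, hW, -, hlast⟩ | ⟨-, hnone⟩
  · rcases hk with ⟨W', -, hW', hWk', -⟩ | ⟨rfl, -⟩
    · obtain rfl := hwf.unique_write W W' v hW hW'
      exact (hlast U hUL u hU (hUm.trans hml)).trans hWk'
    · exact (hwf.default_not_written W hW).elim
  · exact (hnone U hUL u hU (hUm.trans hml)).elim

end HoldsAt

theorem HoldsBefore.holdsAt (hinj : Set.InjOn pos L) {X : Op n} {v : V}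
    (hX : r.inv X.2 X.1 = some RegOp.read) (hXL : X ∈ L) (h : r.HoldsBefore v₀ L pos X v) :
    r.HoldsAt v₀ L pos (pos X) v := by
  have hlt : ∀ W ∈ L, ∀ v', r.IsWriteOp W v' → pos W ≤ pos X → pos W < pos X := by
    refine fun W hWL v' hW hle => hle.lt_of_ne fun heq => ?_
    obtain rfl := hinj hWL hXL heq
    simp [IsWriteOp, hX] at hW
  rcases h with ⟨W, hWL, hW, hWX, hlast⟩ | ⟨hv, hnone⟩
  · exact Or.inl ⟨W, hWL, hW, hWX.le, fun W' hWL' v' hW' hle =>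
      hlast W' hWL' v' hW' (hlt W' hWL' v' hW' hle)⟩
  · exact Or.inr ⟨hv, fun W hWL v' hW hle => hnone W hWL v' hW (hlt W hWL v' hW hle)⟩

/-- The operations in `L`, ordered by their positions `pos`, form a linearization of `r`. That
completed writes return an acknowledgement is left out, as it does not constrain the order. -/
structure IsLinearization (r : Run n Var Val Lbl V) (v₀ : V) (L : Set (Op n))
    (pos : Op n → ℕ) : Prop where
  isOp : ∀ X ∈ L, r.IsOp X
  mem_of_completes : ∀ X, r.Completes X → X ∈ L
  injOn : Set.InjOn pos L
  pos_lt : ∀ X ∈ L, ∀ Y ∈ L, r.Precedes X Y → pos X < pos Y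
  holdsBefore : ∀ X e w, r.Returns X e w → r.inv X.2 X.1 = some RegOp.read →
    ∃ v, w = RegResp.val v ∧ r.HoldsBefore v₀ L pos X v

theorem IsLinearizable.exists_isLinearization (h : r.IsLinearizable v₀) :
    ∃ L pos, r.IsLinearization v₀ L pos := by
  obtain ⟨L, pos, hop, hmem, hinj, hlt, hread, -⟩ := h
  exact ⟨L, pos, hop, hmem, hinj, hlt, hread⟩

theorem IsLinearization.holdsAt (hL : r.IsLinearization v₀ L pos) {X : Op n} {v : V}
    (hX : r.IsValOp X v) (hXc : r.Completes X) : r.HoldsAt v₀ L pos (pos X) v := by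
  have hXL := hL.mem_of_completes X hXc
  rcases hX with hW | ⟨hread, e, hXe⟩
  · exact Or.inl ⟨X, hXL, hW, le_rfl, fun _ _ _ _ h => h⟩
  · obtain ⟨v', hv, hv'⟩ := hL.holdsBefore X e _ hXe hread
    obtain rfl := RegResp.val.inj hv
    exact hv'.holdsAt hL.injOn hread hXL

theorem IsLinearizable.eq_of_precedes (h : r.IsLinearizable v₀) (hwf : r.WellFormed v₀)
    {X Y Z : Op n} {a b : V} (hX : r.IsValOp X b) (hY : r.IsValOp Y a) (hZ : r.IsValOp Z b)
    (hXY : r.Precedes X Y) (hYZ : r.Precedes Y Z) (hZc : r.Completes Z) : a = b := by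
  obtain ⟨L, pos, hL⟩ := h.exists_isLinearization
  have hXL := hL.mem_of_completes X hXY.completes
  have hYL := hL.mem_of_completes Y hYZ.completes
  have hZL := hL.mem_of_completes Z hZc
  have hbY : r.HoldsAt v₀ L pos (pos Y) b :=
    (hL.holdsAt hX hXY.completes).between hwf (hL.holdsAt hZ hZc)
      (hL.pos_lt X hXL Y hYL hXY).le (hL.pos_lt Y hYL Z hZL hYZ).le
  exact (hL.holdsAt hY hYZ.completes).unique hL.injOn hbY

theorem IsLinearizable.isValOp_read (h : r.IsLinearizable v₀) {Y R : Op n} {b : V}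
    (hY : r.IsValOp Y b) (hR : r.inv R.2 R.1 = some RegOp.read) (hYR : r.Precedes Y R)
    (hRc : r.Completes R) (hother : ∀ Z, r.IsOp Z → Z ≠ Y → Z ≠ R → r.Precedes Z Y) :
    r.IsValOp R b := by
  obtain ⟨L, pos, hL⟩ := h.exists_isLinearization
  have hYL := hL.mem_of_completes Y hYR.completes
  have hRL := hL.mem_of_completes R hRc
  obtain ⟨e, w, hRe⟩ := hRc
  obtain ⟨v, rfl, hv⟩ := hL.holdsBefore R e w hRe hR
  have hb : r.HoldsAt v₀ L pos (pos R) b := by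
    refine (hL.holdsAt hY hYR.completes).of_le (hL.pos_lt Y hYL R hRL hYR).le ?_
    intro W hWL v' hW _
    rcases eq_or_ne W Y with rfl | hWY
    · exact le_rfl
    have hWR : W ≠ R := by
      rintro rfl
      simp [IsWriteOp, hR] at hW
    exact (hL.pos_lt W hWL Y hYL (hother W (hL.isOp W hWL) hWY hWR)).le
  obtain rfl := (hv.holdsAt hL.injOn hR hRL).unique hL.injOn hb
  exact Or.inr ⟨hR, e, hRe⟩

end Linearization

/-! ### Extending a prefix of a run by a read -/

section Extension

variable {n : ℕ} {Var Val Lbl V : Type*}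

/-- No operation of process `j` is pending at time `T`: each of them invoked before `T` is followed
by a response before `T`. -/
def IdleAt (r : Run n Var Val Lbl V) (j : Fin n) (T : ℕ) : Prop :=
  ∀ t < T, r.IsOp (j, t) → ∃ s w, t < s ∧ s < T ∧ r.act s j = Act.ret w

theorem Isolated.precedes_of_le {r : Run n Var Val Lbl V} {Y Z : Op n} {e : ℕ} {w : RegResp V}
    (hiso : r.Isolated Y) (hYe : r.Returns Y e w) (hZ : r.IsOp Z) (hZY : Z ≠ Y) (hZe : Z.2 ≤ e) :
    r.Precedes Z Y := by
  refine (hiso Z hZ hZY).resolve_right ?_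
  rintro ⟨-, e', w', hYe', he'⟩
  have := (hYe.unique hYe').1
  omega

theorem Isolated.idleAt {r : Run n Var Val Lbl V} {Y : Op n} {e : ℕ} {w : RegResp V}
    (hiso : r.Isolated Y) (hYe : r.Returns Y e w) : r.IdleAt Y.1 e := by
  intro t ht hop
  have hYlt := hYe.start_lt
  rcases eq_or_ne (Y.1, t) Y with h | h
  · obtain rfl : Y.2 = t := (congrArg Prod.snd h).symm
    obtain ⟨-, s, rfl, hYs, hret, -⟩ := hYe
    exact ⟨s, w, hYs, s.lt_succ_self, hret⟩
  · obtain ⟨-, _, w', ⟨-, s, rfl, hts, hret, -⟩, hlt⟩ := hiso.precedes_of_le hYe hop h ht.le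
    exact ⟨s, w', hts, by omega, hret⟩

/-- `q` agrees with `r` before time `T`, and the only invocation from then on is that of a read at
process `j` in round `T + 2`. -/
structure ExtendsByRead (r q : Run n Var Val Lbl V) (T : ℕ) (j : Fin n) : Prop where
  act : ∀ t < T, q.act t = r.act t
  inv : ∀ t < T, q.inv t = r.inv t
  inv_read : q.inv (T + 1) j = some RegOp.read
  inv_none : ∀ t i, T ≤ t → (i, t) ≠ (j, T + 1) → q.inv t i = none

namespace ExtendsByRead

variable {r q : Run n Var Val Lbl V} {T : ℕ} {j : Fin n} {X Y : Op n}

theorem isOp_read (h : r.ExtendsByRead q T j) : q.IsOp (j, T + 1) := by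
  simp [IsOp, h.inv_read]

theorem lt_or_eq (h : r.ExtendsByRead q T j) (hX : q.IsOp X) :
    X.2 < T ∧ r.IsOp X ∨ X = (j, T + 1) := by
  rcases lt_or_ge X.2 T with hlt | hge
  · exact Or.inl ⟨hlt, by rw [IsOp, ← h.inv _ hlt]; exact hX⟩
  · exact Or.inr (by_contra fun hne => hX (h.inv_none X.2 X.1 hge hne))

theorem isWriteOp {v : V} (h : r.ExtendsByRead q T j) (hX : q.IsWriteOp X v) :
    r.IsWriteOp X v := by
  have hop : q.IsOp X := by rw [IsOp, show q.inv X.2 X.1 = _ from hX]; simp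
  rcases h.lt_or_eq hop with ⟨hlt, -⟩ | rfl
  · rw [IsWriteOp, ← h.inv _ hlt]
    exact hX
  · simp [IsWriteOp, h.inv_read] at hX

theorem wellFormed {v₀ : V} (h : r.ExtendsByRead q T j) (hr : r.WellFormed v₀)
    (hj : r.IdleAt j T) : q.WellFormed v₀ where
  sequential i t t' htt' ht ht' := by
    have ht_lt : t < T ∧ r.IsOp (i, t) := by
      refine (h.lt_or_eq ht).resolve_right fun heq => ?_
      obtain ⟨rfl, rfl⟩ := Prod.mk.inj heq
      rcases h.lt_or_eq ht' with ⟨hlt, -⟩ | heq'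
      · exact absurd (htt'.trans hlt) (by simp)
      · exact htt'.ne' (Prod.mk.inj heq').2
    obtain ⟨ht_lt, ht⟩ := ht_lt
    rcases h.lt_or_eq ht' with ⟨hlt', ht'⟩ | heq'
    · obtain ⟨s, w, hts, hst', hret⟩ := hr.sequential i t t' htt' ht ht'
      exact ⟨s, w, hts, hst', by rw [h.act s (hst'.trans hlt'), hret]⟩
    · obtain ⟨rfl, rfl⟩ := Prod.mk.inj heq'
      obtain ⟨s, w, hts, hsT, hret⟩ := hj t ht_lt ht
      exact ⟨s, w, hts, by omega, by rw [h.act s hsT, hret]⟩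
  unique_write X Y v hX hY := hr.unique_write X Y v (h.isWriteOp hX) (h.isWriteOp hY)
  default_not_written X hX := hr.default_not_written X (h.isWriteOp hX)

theorem returns {e : ℕ} {w : RegResp V} (h : r.ExtendsByRead q T j) (he : e ≤ T)
    (hX : r.Returns X e w) : q.Returns X e w := by
  obtain ⟨hop, s, rfl, hXs, hret, hfirst⟩ := hX
  refine ⟨?_, s, rfl, hXs, ?_, fun u w' hu hu' => ?_⟩
  · rwa [IsOp, h.inv _ (by omega)]
  · rwa [h.act s he]
  · rw [h.act u (by omega)]
    exact hfirst u w' hu hu'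

theorem isValOp {v : V} {e : ℕ} {w : RegResp V} (h : r.ExtendsByRead q T j) (he : e ≤ T)
    (hXe : r.Returns X e w) (hX : r.IsValOp X v) : q.IsValOp X v := by
  rw [IsValOp, h.inv _ (hXe.start_lt.trans_le he)]
  refine hX.imp_right fun ⟨hread, e', hXe'⟩ => ⟨hread, e', h.returns ?_ hXe'⟩
  rwa [(hXe'.unique hXe).1]

theorem precedes (h : r.ExtendsByRead q T j) (hY : Y.2 < T) (hXY : r.Precedes X Y) :
    q.Precedes X Y := by
  obtain ⟨hop, e, w, hXe, heY⟩ := hXY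
  refine ⟨?_, e, w, h.returns (heY.trans hY).le hXe, heY⟩
  rwa [IsOp, h.inv _ hY]

theorem precedes_read {e : ℕ} {w : RegResp V} (h : r.ExtendsByRead q T j) (he : e ≤ T)
    (hXe : r.Returns X e w) : q.Precedes X (j, T + 1) :=
  ⟨h.isOp_read, e, w, h.returns he hXe, Nat.lt_succ_of_le he⟩

theorem isValOp_read {v₀ b : V} {e : ℕ} {w : RegResp V} (h : r.ExtendsByRead q e j)
    (hlin : q.IsLinearizable v₀) (hiso : r.Isolated Y) (hYe : r.Returns Y e w)
    (hY : r.IsValOp Y b) (hR : q.Completes (j, e + 1)) : q.IsValOp (j, e + 1) b := by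
  refine hlin.isValOp_read (h.isValOp le_rfl hYe hY) h.inv_read (h.precedes_read le_rfl hYe) hR
    fun Z hZ hZY hZR => ?_
  obtain ⟨hZe, hZ⟩ := (h.lt_or_eq hZ).resolve_right hZR
  exact h.precedes hYe.start_lt (hiso.precedes_of_le hYe hZ hZY hZe.le)

theorem of_agree {p : Run n Var Val Lbl V} (h : r.ExtendsByRead p T j)
    (hact : ∀ t < T + 2, q.act t = p.act t) (hinv : ∀ t < T + 2, q.inv t = p.inv t)
    (hnone : ∀ t, T + 2 ≤ t → ∀ i, q.inv t i = none) : r.ExtendsByRead q T j where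
  act t ht := (hact t (by omega)).trans (h.act t ht)
  inv t ht := (hinv t (by omega)).trans (h.inv t ht)
  inv_read := by rw [hinv _ (by omega), h.inv_read]
  inv_none t i ht hne := by
    rcases lt_or_ge t (T + 2) with hlt | hge
    · rw [hinv t hlt, h.inv_none t i ht hne]
    · exact hnone t hge i

end ExtendsByRead

/-- Starting in `σ`, nobody acts, and a read is invoked at process `j` in the second round. -/
def idleRead (σ : GState n Var Val Lbl V) (j : Fin n) : Run n Var Val Lbl V where
  state t := { σ with
    loc := fun i => σ.loc i ++ if 2 ≤ t ∧ i = j then [Rec.invoke RegOp.read] else [] }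
  act _ _ := Act.null
  prop _ _ := False
  inv t i := if t = 1 ∧ i = j then some RegOp.read else none

theorem idleRead_state_zero (σ : GState n Var Val Lbl V) (j : Fin n) :
    (idleRead σ j).state 0 = σ := by
  simp [idleRead]

theorem extendsByRead_glue_idleRead (r : Run n Var Val Lbl V) (σ : GState n Var Val Lbl V)
    (T : ℕ) (j : Fin n) : r.ExtendsByRead (r.glue T (idleRead σ j) 0) T j where
  act t ht := if_pos ht
  inv t ht := if_pos ht
  inv_read := by simp [glue, idleRead]
  inv_none t i ht hne := by
    simp only [glue, if_neg (not_lt.2 ht), idleRead, ite_eq_right_iff]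
    rintro ⟨ht', rfl⟩
    exact absurd (congrArg (Prod.mk i) (show t = T + 1 by omega)) hne

variable [DecidableEq Var] {I : RegImpl n Var Val Lbl V}

theorem validRound_idleRead (σ : GState n Var Val Lbl V) (j : Fin n)
    (I : RegImpl n Var Val Lbl V) (t : ℕ) : (idleRead σ j).ValidRound I t := by
  refine validRound_of_idle (fun _ => rfl) (fun _ => id) rfl rfl fun i => ?_
  by_cases hi : i = j
  · rcases t with _ | _ | t <;> simp [idleRead, hi]
  · simp [idleRead, hi]

theorem exists_extendsByRead {r : Run n Var Val Lbl V} {v₀ : V} {T : ℕ} {j : Fin n}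
    (hfree : I.ObstructionFree v₀) (hr : r.IsRunOf I) (hwf : r.WellFormed v₀)
    (hj : r.IdleAt j T) :
    ∃ q : Run n Var Val Lbl V, q.IsRunOf I ∧ q.WellFormed v₀ ∧ q.state T = r.state T ∧
      r.ExtendsByRead q T j ∧ q.Completes (j, T + 1) := by
  set p := r.glue T (idleRead (r.state T) j) 0
  have hstate : r.state T = (idleRead (r.state T) j).state 0 := (idleRead_state_zero _ _).symm
  have hpT : p.state T = r.state T := by
    rw [(sameRound_glue_of_le le_rfl).state, Nat.sub_self, idleRead_state_zero]
  have hp : p.IsRunOf I := hr.glue (fun t _ => validRound_idleRead _ j I t) hstate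
  have hpext : r.ExtendsByRead p T j := r.extendsByRead_glue_idleRead _ T j
  obtain ⟨q, hq, hqstate, hqp, hqinv, -, hqR⟩ := hfree p hp (hpext.wellFormed hwf hj) (j, T + 1)
    (T + 2) hpext.isOp_read (T + 1).lt_succ_self fun e w hpe => by
      obtain ⟨-, s, rfl, hs, -⟩ := hpe
      exact Nat.succ_lt_succ hs
  have hqext : r.ExtendsByRead q T j :=
    hpext.of_agree (fun t ht => (hqp t ht).1) (fun t ht => (hqp t ht).2.2) hqinv
  exact ⟨q, hq, hqext.wellFormed hwf hj, (hqstate T (by omega)).trans hpT, hqext, hqR⟩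

end Extension

end Run

end TSO

theorem mainTheorem4 {n : ℕ} {Var Val Lbl V : Type*} [DecidableEq Var]
    (v₀ : V) (I : TSO.RegImpl n Var Val Lbl V)
    (hlin : I.Linearizable v₀) (hfree : I.ObstructionFree v₀)
    (r : TSO.Run n Var Val Lbl V) (hr : r.IsRunOf I) (hwf : r.WellFormed v₀)
    (hrace : r.NoReadPropRace)
    (X Y : TSO.Op n) (a b : V) (hab : a ≠ b)
    (hX : r.IsValOp X a) (hY : r.IsValOp Y b)
    (hXY : r.Precedes X Y) (hcomp : r.Completes Y) (hiso : r.Isolated Y) :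
    r.OpOB X Y := by
  open TSO TSO.Run in
  obtain ⟨e, w, hYe⟩ := hcomp
  obtain ⟨-, eX, wX, hXe, heXY⟩ := hXY
  have hYlt : Y.2 < e := hYe.start_lt
  have hXlt : X.2 < eX := hXe.start_lt
  by_contra hob
  obtain ⟨q, hq, hqwf, hqr, hext, hR⟩ := exists_extendsByRead hfree hr hwf (hiso.idleAt hYe)
  have hRb : q.IsValOp (Y.1, e + 1) b := hext.isValOp_read (hlin q hq hqwf) hiso hYe hY hR
  have hqX : q.Returns X eX wX := hext.returns (by omega) hXe
  obtain ⟨τ, hτ, hτe, hτX, hτY⟩ := r.exists_isCut_of_node (Agent.proc X.1, X.2) e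
  have hne : (Agent.proc X.1, X.2) ≠ (Agent.proc Y.1, e) := fun h => by
    have : X.2 = e := congrArg Prod.snd h
    omega
  have hτY : τ (Agent.proc Y.1) = e := hτY _ (not_or.2 ⟨hne, fun h => hob ⟨e, w, hYe, h⟩⟩)
  obtain ⟨r', hr', hins⟩ :=
    exists_isRunOf_insertsIdle hr hrace hq hqr hext.act hext.inv hτ hτe e.le_succ
  have hYX := hins.precedes_shiftOp_of_delayed (hext.returns le_rfl hYe) hτY.ge hqX.1 hτX (by omega)
  have hXR := hins.precedes_shiftOp (hext.precedes_read (by omega) hXe) (hτY.le.trans e.le_succ)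
  have hwf' : r'.WellFormed v₀ := hins.wellFormed hqwf
  exact hab <| (hlin r' hr' hwf').eq_of_precedes hwf' (hins.isValOp (hext.isValOp le_rfl hYe hY))
    (hins.isValOp (hext.isValOp (by omega) hXe hX)) (hins.isValOp hRb) hYX hXR (hins.completes hR)
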